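/- There are absolute constants $C, c_0, c_1 > 0$ such that the following holds. Let $n = k\ell$ with integers $k, \ell \ge 1$ (so $1 \le \ell \le n$), let $d \ge 1$, $\delta \in (0, 1/2)$ and $\theta \in \mathbf{R}^d$. Suppose that $$Y_i = \eta_i \theta + \xi_i, \qquad i = 1, \dots, n,$$ where $(\eta_i)_{1\le i\le n}$ is a homogeneous Markov chain on $\{-1, 1\}$, with $\eta_1$ a Rademacher variable, $\eta_{i+1} = \eta_i$ with probability $1-\delta$ and $\eta_{i+1} = -\eta_i$ with probability $\delta$, and where the $\xi_i$ are i.i.d. random vectors, independent of $(\eta_i)$, which are isotropic, $\mathbf{E}\,\xi_i\xi_i^\top = \mathbf{I}_d$, and $1$-sub-Gaussian, $\mathbf{E} \exp\langle v, \xi_i\rangle \le \exp(\|v\|^2/2)$ for all $v \in \mathbf{R}^d$. Split $\{1, \dots, n\}$ into $\ell$ consecutive buckets of length $k$, let $\tilde Y$ be the $d \times \ell$ matrix whose columns are the means of the observations $Y_j$ over the buckets, and put $\hat\Sigma = \frac{1}{\ell} \tilde Y \tilde Y^\top$ and $$\tilde\theta(\ell) = \sqrt{\left(\lambda_{\max}(\hat\Sigma)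 - \tfrac1k\right)_+}\; v_{\max}(\hat\Sigma),$$ where $\lambda_{\max}$ is the top eigenvalue and $v_{\max}$ is any corresponding unit eigenvector. Measure the error by the loss $L(a, b) = \min\{\|a - b\|, \|a + b\|\}$. Then: (i) If $0 < \|\theta\|^2 \le 1$, then with probability at least $1 - c_1 e^{-c_0 d}$, $$L(\tilde\theta(\ell), \theta) \le C\left[\left(\sqrt{\frac{d}{\ell}} + \frac{n\delta}{\ell}\right)\|\theta\| + \sqrt{\frac{d}{n}} + \frac{1}{\|\theta\|}\left(\sqrt{\frac1k}\sqrt{\frac dn} + \frac dn\right)\right].$$ (ii) If $\|\theta\|^2 \ge 1$ and $\ell = n$, then with probability at least $1 - c_1 e^{-c_0 d}$, $$L(\tilde\theta(n), \theta) \le C\left[\sqrt{\frac dn} + \frac dn\right].$$ -/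

import Mathlib

open MeasureTheory ProbabilityTheory

/-- The loss `min {‖a - b‖, ‖a + b‖}`: Euclidean distance up to a global sign flip. -/
noncomputable def signLoss {d : ℕ} (a b : EuclideanSpace ℝ (Fin d)) : ℝ :=
  min ‖a - b‖ ‖a + b‖

/-- `X` is a `1`-sub-Gaussian random vector: `E exp⟨v, X⟩ ≤ exp (‖v‖² / 2)` for all `v`
(the expectation being finite). -/
structure IsSubGaussianVector {Ω : Type*} [MeasurableSpace Ω] {d : ℕ} (P : Measure Ω)
    (X : Ω → EuclideanSpace ℝ (Fin d)) : Prop where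
  integrable_exp : ∀ v : EuclideanSpace ℝ (Fin d),
    Integrable (fun ω => Real.exp (inner ℝ v (X ω))) P
  integral_exp_le : ∀ v : EuclideanSpace ℝ (Fin d),
    ∫ ω, Real.exp (inner ℝ v (X ω)) ∂P ≤ Real.exp (‖v‖ ^ 2 / 2)

/-- `X` is isotropic: `E X Xᵀ` is the identity matrix. -/
def IsIsotropicVector {Ω : Type*} [MeasurableSpace Ω] {d : ℕ} (P : Measure Ω)
    (X : Ω → EuclideanSpace ℝ (Fin d)) : Prop :=
  ∀ a b : Fin d, ∫ ω, X ω a * X ω b ∂P = (1 : Matrix (Fin d) (Fin d) ℝ) a b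

/-- `η` is a homogeneous symmetric Markov chain (of length `n`) on `{-1, 1}` with flip
probability `δ`: the first label is a Rademacher variable, and, conditionally on the whole past,
the next label equals the present one with probability `1 - δ` and is flipped with
probability `δ`. -/
structure IsSymmetricSignChain {Ω : Type*} [MeasurableSpace Ω] {n : ℕ} (P : Measure Ω) (δ : ℝ)
    (η : Fin n → Ω → ℝ) : Prop where
  measurable : ∀ i, Measurable (η i)
  sign : ∀ i ω, η i ω = 1 ∨ η i ω = -1
  initial : ∀ i : Fin n, (i : ℕ) = 0 →
    P.real {ω | η i ω = 1} = 1 / 2 ∧ P.real {ω | η i ω = -1} = 1 / 2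
  step : ∀ i j : Fin n, (j : ℕ) = (i : ℕ) + 1 →
    ∀ s : Fin n → ℝ, (∀ r, s r = 1 ∨ s r = -1) →
      P.real {ω | ∀ r, r ≤ j → η r ω = s r} =
        (if s j = s i then 1 - δ else δ) * P.real {ω | ∀ r, r ≤ i → η r ω = s r}

/-- The hidden Markov sub-Gaussian mixture model: `Y i = η i • θ + ξ i`, with hidden labels `η`
forming a symmetric Markov chain with flip probability `δ`, and i.i.d. isotropic
`1`-sub-Gaussian noise vectors `ξ i` that are independent of the labels. -/
structure IsMarkovMixture {Ω : Type*} [MeasurableSpace Ω] {n d : ℕ} (P : Measure Ω) (δ : ℝ)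
    (θ : EuclideanSpace ℝ (Fin d)) (η : Fin n → Ω → ℝ)
    (ξ Y : Fin n → Ω → EuclideanSpace ℝ (Fin d)) : Prop where
  chain : IsSymmetricSignChain P δ η
  noise_measurable : ∀ i, Measurable (ξ i)
  noise_indep : iIndepFun ξ P
  noise_identDistrib : ∀ i j, IdentDistrib (ξ i) (ξ j) P P
  noise_isotropic : ∀ i, IsIsotropicVector P (ξ i)
  noise_subGaussian : ∀ i, IsSubGaussianVector P (ξ i)
  indep : IndepFun (fun ω i => η i ω) (fun ω i => ξ i ω) P
  model : ∀ i ω, Y i ω = η i ω • θ + ξ i ω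

/-- The mean of the observations in the `i`-th bucket; the buckets are the consecutive blocks of
`k` indices, that is, bucket `i` consists of the indices `i k, i k + 1, …, i k + k - 1`. -/
noncomputable def bucketMean {n d : ℕ} (k : ℕ) {l : ℕ}
    (y : Fin n → EuclideanSpace ℝ (Fin d)) (i : Fin l) : EuclideanSpace ℝ (Fin d) :=
  (1 / (k : ℝ)) • ∑ j ∈ Finset.univ.filter (fun j : Fin n => (j : ℕ) / k = (i : ℕ)), y j

/-- The `d × l` matrix whose columns are the bucket means. -/
noncomputable def bucketMatrix {n d : ℕ} (k l : ℕ) (y : Fin n → EuclideanSpace ℝ (Fin d)) :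
    Matrix (Fin d) (Fin l) ℝ :=
  Matrix.of fun a i => bucketMean k y i a

/-- The sample covariance matrix of the bucket means. -/
noncomputable def sampleCov {n d : ℕ} (k l : ℕ) (y : Fin n → EuclideanSpace ℝ (Fin d)) :
    Matrix (Fin d) (Fin d) ℝ :=
  (1 / (l : ℝ)) • (bucketMatrix k l y * (bucketMatrix k l y).transpose)

/-- The top eigenvalue of a (symmetric real) matrix. -/
noncomputable def lambdaMax {d : ℕ} (A : Matrix (Fin d) (Fin d) ℝ) : ℝ :=
  sSup {x : ℝ | Module.End.HasEigenvalue (Matrix.toEuclideanLin A) x}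

/-- `v` is a unit eigenvector of `A` for its top eigenvalue. -/
def IsTopEigenvector {d : ℕ} (A : Matrix (Fin d) (Fin d) ℝ) (v : EuclideanSpace ℝ (Fin d)) :
    Prop :=
  ‖v‖ = 1 ∧ Matrix.toEuclideanLin A v = lambdaMax A • v

/-- `T`, a function of the observations only, is a version of the spectral estimator
`√((λ_max(Σ̂) - 1/k)₊) v_max(Σ̂)`. A top unit eigenvector is never unique (at least its sign is
free), so `T` may use any choice of it. -/
def IsSpectralEstimator {n d : ℕ} (k l : ℕ)
    (T : (Fin n → EuclideanSpace ℝ (Fin d)) → EuclideanSpace ℝ (Fin d)) : Prop :=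
  ∀ y, ∃ v, IsTopEigenvector (sampleCov k l y) v ∧
    T y = √(max (lambdaMax (sampleCov k l y) - 1 / (k : ℝ)) 0) • v

/-! Write `a i` for the label average and `z i` for the noise mean of bucket `i`, so that the bucket
mean is `a i • θ + z i`. Expanding the sample covariance gives `Σ̂ - I/k - θθᵀ = -μ θθᵀ + (θwᵀ +
wθᵀ) + (Σ̂_noise - I/k)`, where `μ` is the mean of `1 - (a i)²` over the buckets and `w` is the mean
of `a i • z i` (`crossNoise`). If the right side has operator norm at most `ε`, the rescaled top
eigenvector is within `10 ε / ‖θ‖` of `±θ` (`min_norm_sub_norm_add_le_of_top_eigenpair`). Hence the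
loss is of order `μ‖θ‖ + ‖w‖ + ν/‖θ‖`, with `ν` the operator norm of the noise deviation
(`signLoss_spectral_le`).

Each of the three terms is controlled separately. A bucket contributes to `μ` only if the chain
flips in it, so `l μ` is at most the number of flips, whose exponential moment is bounded by peeling
off one transition at a time. Once the labels are frozen, `w` is a linear combination of the noises
with coefficients at most `1/n`, so a Hoeffding bound applies. For `ν`, the squared normalised
bucket sums are independent and sub-exponential, so a Bernstein bound applies.

The last two bounds are proved in one direction with tail `2 exp(-4d)` and extended to all
directions by a net of at most `5^d ≤ exp(3d)` points, which leaves `2 exp(-d)`. In the second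
regime the buckets are singletons, so `μ = 0`, and dividing by `‖θ‖ ≥ 1` costs nothing. -/

/-! ### Nets of the sphere, symmetric operators, rank-one perturbation -/

section LinearAlgebra

variable {E : Type*} [NormedAddCommGroup E] [InnerProductSpace ℝ E]

/-- A finite `1/2`-net of the unit sphere, of cardinality exponential in the dimension. -/
theorem exists_half_net_sphere [FiniteDimensional ℝ E] :
    ∃ N : Finset E, N.card ≤ 5 ^ Module.finrank ℝ E ∧ (∀ y ∈ N, ‖y‖ = 1) ∧
      ∀ x : E, ‖x‖ = 1 → ∃ y ∈ N, ‖y - x‖ ≤ 1 / 2 := by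
  classical
  let p : Finset E → Prop := fun s =>
    (∀ y ∈ s, ‖y‖ = 1) ∧ ∀ a ∈ s, ∀ b ∈ s, a ≠ b → 1 / 2 ≤ ‖a - b‖
  have hcard : ∀ s, p s → s.card ≤ 5 ^ Module.finrank ℝ E := by
    rintro s ⟨h1, h2⟩
    -- Dilating by `2` turns unit vectors at mutual distance `1/2` into vectors of norm `2` at
    -- mutual distance `1`, the normalisation of `Besicovitch.card_le_of_separated`.
    have hinj : Function.Injective (fun x : E => (2 : ℝ) • x) :=
      smul_right_injective E two_ne_zero
    rw [← Finset.card_image_of_injective s hinj]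
    apply Besicovitch.card_le_of_separated
    · intro c hc
      obtain ⟨y, hy, rfl⟩ := Finset.mem_image.1 hc
      simp [norm_smul, h1 y hy]
    · intro c hc c' hc' hne
      obtain ⟨y, hy, rfl⟩ := Finset.mem_image.1 hc
      obtain ⟨y', hy', rfl⟩ := Finset.mem_image.1 hc'
      have hyy : y ≠ y' := fun h => hne (by simp [h])
      have := h2 y hy y' hy' hyy
      simp only [← smul_sub, norm_smul, Real.norm_ofNat]
      linarith
  let Q : ℕ → Prop := fun m => ∃ s, p s ∧ s.card = m
  have hQ0 : Q 0 := ⟨∅, by simp [p], rfl⟩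
  -- A separated set of largest cardinality is a net: an uncovered point could be added to it.
  obtain ⟨N, hN, hNc⟩ := Nat.findGreatest_spec (P := Q) (Nat.zero_le (5 ^ Module.finrank ℝ E)) hQ0
  refine ⟨N, hcard N hN, hN.1, fun x hx => ?_⟩
  by_contra! hcon
  have hxN : x ∉ N := fun h => by
    have := hcon x h
    rw [sub_self, norm_zero] at this
    norm_num at this
  have hp : p (insert x N) := by
    refine ⟨fun y hy => ?_, fun a ha b hb hab => ?_⟩
    · rcases Finset.mem_insert.1 hy with rfl | hy
      exacts [hx, hN.1 y hy]
    · rcases Finset.mem_insert.1 ha with ha | ha <;> rcases Finset.mem_insert.1 hb with hb | hb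
      · exact absurd (ha.trans hb.symm) hab
      · rw [ha, norm_sub_rev]; exact (hcon b hb).le
      · rw [hb]; exact (hcon a ha).le
      · exact hN.2 a ha b hb hab
  have hle := Nat.le_findGreatest (P := Q) (hcard _ hp) ⟨_, hp, rfl⟩
  rw [Finset.card_insert_of_notMem hxN] at hle
  omega

theorem norm_le_two_mul_of_half_net {N : Finset E}
    (hN : ∀ x : E, ‖x‖ = 1 → ∃ y ∈ N, ‖y - x‖ ≤ 1 / 2) {w : E} {t : ℝ} (ht : 0 ≤ t)
    (h : ∀ y ∈ N, inner ℝ y w ≤ t) : ‖w‖ ≤ 2 * t := by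
  by_cases hw : w = 0
  · simp [hw, ht]
  have hw' : 0 < ‖w‖ := norm_pos_iff.2 hw
  obtain ⟨y, hy, hyx⟩ := hN (‖w‖⁻¹ • w) (by simp [norm_smul, hw'.ne'])
  have h1 : inner ℝ (y - ‖w‖⁻¹ • w) w ≥ -(1 / 2 * ‖w‖) := by
    have := abs_real_inner_le_norm (y - ‖w‖⁻¹ • w) w
    have h3 : ‖y - ‖w‖⁻¹ • w‖ * ‖w‖ ≤ 1 / 2 * ‖w‖ := by gcongr
    have := neg_abs_le (inner ℝ (y - ‖w‖⁻¹ • w) w)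
    linarith
  rw [inner_sub_left, inner_smul_left, real_inner_self_eq_norm_sq] at h1
  have h2 : (starRingEnd ℝ) ‖w‖⁻¹ * ‖w‖ ^ 2 = ‖w‖ := by
    simp; field_simp
  rw [h2] at h1
  have := h y hy
  linarith

/-- Polarisation on `u ± v`, combined with the parallelogram law. -/
theorem LinearMap.IsSymmetric.inner_apply_le_of_quadratic {T : E →ₗ[ℝ] E} (hT : T.IsSymmetric)
    {q : ℝ} (h : ∀ x, |inner ℝ (T x) x| ≤ q * ‖x‖ ^ 2) (u v : E) (hu : ‖u‖ = 1) (hv : ‖v‖ = 1) :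
    inner ℝ (T u) v ≤ q := by
  have hsymm : inner ℝ (T v) u = inner ℝ (T u) v := by
    rw [hT v u, real_inner_comm]
  have h1 := (abs_le.1 (h (u + v))).2
  have h2 := (abs_le.1 (h (u - v))).1
  have h3 := parallelogram_law_with_norm ℝ u v
  simp only [map_add, map_sub, inner_add_left, inner_add_right, inner_sub_left, inner_sub_right,
    hsymm] at h1 h2
  rw [hu, hv] at h3
  have h4 : q * (‖u + v‖ ^ 2 + ‖u - v‖ ^ 2) = q * 4 := by
    congr 1; nlinarith
  linarith

theorem LinearMap.IsSymmetric.norm_apply_le_of_quadratic {T : E →ₗ[ℝ] E} (hT : T.IsSymmetric)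
    {q : ℝ} (h : ∀ x, |inner ℝ (T x) x| ≤ q * ‖x‖ ^ 2) (u : E) : ‖T u‖ ≤ q * ‖u‖ := by
  by_cases hu : u = 0
  · simp [hu]
  by_cases hTu : T u = 0
  · rw [hTu, norm_zero]
    have := (abs_nonneg _).trans (h u)
    have hu' : 0 < ‖u‖ := norm_pos_iff.2 hu
    nlinarith [hu']
  have hu' : 0 < ‖u‖ := norm_pos_iff.2 hu
  have hTu' : 0 < ‖T u‖ := norm_pos_iff.2 hTu
  have := hT.inner_apply_le_of_quadratic h (‖u‖⁻¹ • u) (‖T u‖⁻¹ • T u)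
    (by simp [norm_smul, hu'.ne']) (by simp [norm_smul, hTu'.ne'])
  rw [map_smul, inner_smul_left, inner_smul_right, real_inner_self_eq_norm_sq] at this
  have h2 : (starRingEnd ℝ) ‖u‖⁻¹ * (‖T u‖⁻¹ * ‖T u‖ ^ 2) = ‖T u‖ / ‖u‖ := by
    simp; field_simp
  rw [h2, div_le_iff₀ hu'] at this
  exact this

/-- In finite dimension the supremum and the infimum of the Rayleigh quotient are both eigenvalues;
the one of larger modulus serves as `μ`. -/
theorem LinearMap.IsSymmetric.exists_eigenvector_dominating [FiniteDimensional ℝ E] [Nontrivial E]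
    {T : E →ₗ[ℝ] E} (hT : T.IsSymmetric) :
    ∃ (μ : ℝ) (x : E), ‖x‖ = 1 ∧ T x = μ • x ∧ ∀ y, |inner ℝ (T y) y| ≤ |μ| * ‖y‖ ^ 2 := by
  have hunit : ∀ {a : ℝ}, Module.End.HasEigenvalue T a → ∃ x : E, ‖x‖ = 1 ∧ T x = a • x := by
    intro a ha
    obtain ⟨x, hx⟩ := ha.exists_hasEigenvector
    have hx0 : 0 < ‖x‖ := norm_pos_iff.2 hx.2
    exact ⟨‖x‖⁻¹ • x, by simp [norm_smul, hx0.ne'], by rw [map_smul, hx.apply_eq_smul, smul_comm]⟩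
  have hbound : ∃ B : ℝ, ∀ x : { x : E // x ≠ 0 },
      |RCLike.re (inner ℝ (T x) (x : E)) / ‖(x : E)‖ ^ 2| ≤ B := by
    refine ⟨‖T.toContinuousLinearMap‖, fun x => ?_⟩
    have hx0 : 0 < ‖(x : E)‖ := norm_pos_iff.2 x.2
    rw [abs_div, abs_of_nonneg (sq_nonneg ‖(x : E)‖), div_le_iff₀ (by positivity)]
    calc |RCLike.re (inner ℝ (T x) (x : E))| ≤ ‖T x‖ * ‖(x : E)‖ := abs_real_inner_le_norm _ _
      _ ≤ ‖T.toContinuousLinearMap‖ * ‖(x : E)‖ * ‖(x : E)‖ := by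
        gcongr; exact T.toContinuousLinearMap.le_opNorm x
      _ = _ := by ring
  obtain ⟨B, hB⟩ := hbound
  set s := ⨆ x : { x : E // x ≠ 0 }, RCLike.re (inner ℝ (T x) (x : E)) / ‖(x : E)‖ ^ 2 with hs
  set i := ⨅ x : { x : E // x ≠ 0 }, RCLike.re (inner ℝ (T x) (x : E)) / ‖(x : E)‖ ^ 2 with hi
  have hsE : Module.End.HasEigenvalue T s := hT.hasEigenvalue_iSup_of_finiteDimensional
  have hiE : Module.End.HasEigenvalue T i := hT.hasEigenvalue_iInf_of_finiteDimensional
  have hsup : ∀ y : E, y ≠ 0 → inner ℝ (T y) y ≤ s * ‖y‖ ^ 2 := by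
    intro y hy
    have hy0 : 0 < ‖y‖ := norm_pos_iff.2 hy
    rw [← div_le_iff₀ (by positivity)]
    exact le_ciSup (f := fun x : { x : E // x ≠ 0 } =>
      RCLike.re (inner ℝ (T x) (x : E)) / ‖(x : E)‖ ^ 2)
      ⟨B, by rintro _ ⟨x, rfl⟩; exact (abs_le.1 (hB x)).2⟩ ⟨y, hy⟩
  have hinf : ∀ y : E, y ≠ 0 → i * ‖y‖ ^ 2 ≤ inner ℝ (T y) y := by
    intro y hy
    have hy0 : 0 < ‖y‖ := norm_pos_iff.2 hy
    rw [← le_div_iff₀ (by positivity)]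
    exact ciInf_le (f := fun x : { x : E // x ≠ 0 } =>
      RCLike.re (inner ℝ (T x) (x : E)) / ‖(x : E)‖ ^ 2)
      ⟨-B, by rintro _ ⟨x, rfl⟩; exact (abs_le.1 (hB x)).1⟩ ⟨y, hy⟩
  have key : ∀ μ : ℝ, |s| ≤ |μ| → |i| ≤ |μ| → ∀ y, |inner ℝ (T y) y| ≤ |μ| * ‖y‖ ^ 2 := by
    intro μ h1 h2 y
    by_cases hy : y = 0
    · simp [hy]
    have hy2 : 0 ≤ ‖y‖ ^ 2 := by positivity
    have a1 := hsup y hy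
    have a2 := hinf y hy
    have a3 := mul_le_mul_of_nonneg_right ((le_abs_self s).trans h1) hy2
    have a4 := mul_le_mul_of_nonneg_right ((neg_le_neg h2).trans (neg_abs_le i)) hy2
    rw [abs_le]
    constructor <;> linarith
  rcases le_total |i| |s| with h | h
  · obtain ⟨x, hx, hTx⟩ := hunit hsE
    exact ⟨s, x, hx, hTx, key s le_rfl h⟩
  · obtain ⟨x, hx, hTx⟩ := hunit hiE
    exact ⟨i, x, hx, hTx, key i h le_rfl⟩

/-- The operator norm of a symmetric operator is controlled by its quadratic form on a `1/2`-net
of the unit sphere. -/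
theorem LinearMap.IsSymmetric.norm_apply_le_of_half_net [FiniteDimensional ℝ E] [Nontrivial E]
    {T : E →ₗ[ℝ] E} (hT : T.IsSymmetric) {N : Finset E} (hN1 : ∀ y ∈ N, ‖y‖ = 1)
    (hN : ∀ x : E, ‖x‖ = 1 → ∃ y ∈ N, ‖y - x‖ ≤ 1 / 2) {t : ℝ}
    (h : ∀ y ∈ N, |inner ℝ (T y) y| ≤ t) (u : E) : ‖T u‖ ≤ 2 * t * ‖u‖ := by
  obtain ⟨μ, x, hx, hTx, hdom⟩ := hT.exists_eigenvector_dominating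
  obtain ⟨y, hy, hyx⟩ := hN x hx
  -- With `z = y - x` and `‖y‖ = ‖x‖ = 1`, the cross terms combine into `⟨Ty, y⟩ - ⟨Tz, z⟩ = μ (1 -
  -- ‖z‖²)`. As `‖z‖² ≤ 1/4`, this yields `(3/4)|μ| ≤ t + |μ|/4`.
  have hμ : |μ| ≤ 2 * t := by
    set z := y - x with hz
    have hyz : y = x + z := by rw [hz]; abel
    have hn : ‖y‖ ^ 2 = 1 + 2 * inner ℝ x z + ‖z‖ ^ 2 := by
      rw [hyz, norm_add_sq_real, hx]; ring
    rw [hN1 y hy] at hn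
    have hq : inner ℝ (T y) y = μ * (1 - ‖z‖ ^ 2) + inner ℝ (T z) z := by
      have h1 : inner ℝ (T z) x = μ * inner ℝ x z := by
        rw [hT z x, hTx, inner_smul_right, real_inner_comm]
      have h2 : inner ℝ (T x) z = μ * inner ℝ x z := by
        rw [hTx, inner_smul_left]; rfl
      have h3 : inner ℝ (T x) x = μ := by
        rw [hTx, inner_smul_left, real_inner_self_eq_norm_sq, hx]; simp
      rw [hyz, map_add, inner_add_left, inner_add_right, inner_add_right, h1, h2, h3]
      linear_combination -μ * hn
    have hz2 : ‖z‖ ^ 2 ≤ 1 / 4 := by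
      have := norm_nonneg z
      nlinarith
    have h1 := hdom z
    have h2 := h y hy
    have h3 : |μ * (1 - ‖z‖ ^ 2)| ≤ |inner ℝ (T y) y| + |inner ℝ (T z) z| := by
      have : μ * (1 - ‖z‖ ^ 2) = inner ℝ (T y) y - inner ℝ (T z) z := by linarith
      rw [this]; exact abs_sub _ _
    rw [abs_mul, abs_of_nonneg (by linarith : 0 ≤ 1 - ‖z‖ ^ 2)] at h3
    nlinarith [abs_nonneg μ]
  refine (hT.norm_apply_le_of_quadratic hdom u).trans ?_
  gcongr

/-- Perturbation of a rank-one operator: an eigenpair `(lam, v)` of `A ≈ κ + θ θᵀ` whose eigenvalue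
dominates the quadratic form of `A` gives an estimate of `θ`, up to sign. -/
theorem min_norm_sub_norm_add_le_of_top_eigenpair {A : E →ₗ[ℝ] E} {θ v : E} {lam κ ε : ℝ}
    (hθ : θ ≠ 0) (hv : ‖v‖ = 1) (hAv : A v = lam • v)
    (htop : ∀ u, inner ℝ (A u) u ≤ lam * ‖u‖ ^ 2)
    (happrox : ∀ u, ‖A u - κ • u - inner ℝ θ u • θ‖ ≤ ε * ‖u‖) :
    min ‖√(max (lam - κ) 0) • v - θ‖ ‖√(max (lam - κ) 0) • v + θ‖ ≤ 10 * (ε / ‖θ‖) := by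
  wlog hc : 0 ≤ inner ℝ θ v generalizing v with H
  · have := H (v := -v) (by simpa using hv) (by simp [hAv]) (by
      rw [inner_neg_right]; linarith)
    rw [smul_neg, ← norm_neg, ← norm_neg (_ + θ)] at this
    simp only [neg_sub, sub_neg_eq_add, neg_add_rev, neg_neg] at this
    rw [min_comm, add_comm (√_ • v) θ, sub_eq_neg_add (√_ • v)]
    exact this
  have hT : 0 < ‖θ‖ := norm_pos_iff.2 hθ
  set M := lam - κ with hM
  set c := inner ℝ θ v with hcdef
  have hev : ‖M • v - c • θ‖ ≤ ε := by
    have := happrox v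
    rwa [hAv, ← sub_smul, hv, mul_one] at this
  have hε : 0 ≤ ε := (norm_nonneg _).trans hev
  have hMc : |M - c ^ 2| ≤ ε := by
    have h1 := abs_real_inner_le_norm (M • v - c • θ) v
    rw [inner_sub_left, inner_smul_left, inner_smul_left, real_inner_self_eq_norm_sq, hv] at h1
    have h2 : (starRingEnd ℝ) M * 1 ^ 2 - (starRingEnd ℝ) c * inner ℝ θ v = M - c ^ 2 := by
      simp [← hcdef, sq]
    rw [h2] at h1
    linarith
  -- Maximality of `lam` is tested on `θ` itself.
  have hlow : ‖θ‖ ^ 2 - ε ≤ M := by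
    have h1 := htop θ
    have h2 := abs_real_inner_le_norm (A θ - κ • θ - inner ℝ θ θ • θ) θ
    have h3 := happrox θ
    rw [inner_sub_left, inner_sub_left, inner_smul_left, inner_smul_left,
      real_inner_self_eq_norm_sq] at h2
    simp only [conj_trivial] at h2
    have h4 := neg_abs_le (inner ℝ (A θ) θ - κ * ‖θ‖ ^ 2 - ‖θ‖ ^ 2 * ‖θ‖ ^ 2)
    have h5 : ‖A θ - κ • θ - inner ℝ θ θ • θ‖ * ‖θ‖ ≤ ε * ‖θ‖ ^ 2 := by nlinarith
    rw [real_inner_self_eq_norm_sq] at h5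
    have h6 : (‖θ‖ ^ 2 - ε) * ‖θ‖ ^ 2 ≤ M * ‖θ‖ ^ 2 := by rw [hM]; linarith
    exact le_of_mul_le_mul_right h6 (by positivity)
  have hcT : c ≤ ‖θ‖ := by
    have := real_inner_le_norm θ v
    rwa [hv, mul_one] at this
  have hup : M ≤ ‖θ‖ ^ 2 + ε := by
    have := (abs_le.1 hMc).2
    nlinarith
  set a := √(max M 0) with ha
  have ha0 : 0 ≤ a := Real.sqrt_nonneg _
  have ha2 : a ^ 2 = max M 0 := Real.sq_sqrt (le_max_right _ _)
  refine (min_le_left _ _).trans ?_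
  -- If `ε ≥ ‖θ‖²/4` the triangle inequality suffices, since `2‖θ‖ + 2ε/‖θ‖ ≤ 10 ε/‖θ‖`; this is
  -- where `10` comes from. Otherwise `c ≥ ‖θ‖/2`, and the eigenvector relation can be divided by
  -- `c`.
  rcases le_or_gt (‖θ‖ ^ 2 / 4) ε with hbig | hsmall
  · have h1 : ‖θ‖ / 4 ≤ ε / ‖θ‖ := by
      rw [le_div_iff₀ hT]; nlinarith
    have h2 : a ≤ ‖θ‖ + 2 * (ε / ‖θ‖) := by
      have hq : 0 ≤ ε / ‖θ‖ := by positivity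
      have hq2 : ε / ‖θ‖ * ‖θ‖ = ε := div_mul_cancel₀ _ hT.ne'
      apply abs_le_of_sq_le_sq' _ (by positivity) |>.2
      rw [ha2]
      refine max_le ?_ (by positivity)
      nlinarith
    calc ‖a • v - θ‖ ≤ ‖a • v‖ + ‖θ‖ := norm_sub_le _ _
      _ = a + ‖θ‖ := by rw [norm_smul, hv, mul_one, Real.norm_of_nonneg ha0]
      _ ≤ _ := by linarith
  · have hMpos : 0 < M := by nlinarith
    rw [max_eq_left hMpos.le] at ha2
    have hc2 : ‖θ‖ / 2 ≤ c := by
      have := (abs_le.1 hMc).2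
      apply abs_le_of_sq_le_sq' _ hc |>.2
      nlinarith
    have hcpos : 0 < c := by linarith
    have h1 : ‖c • (a • v - θ)‖ ≤ 4 * ε := by
      have hdec : c • (a • v - θ) = (M • v - c • θ) + (c * a - M) • v := by module
      have h3 : |c * a - M| ≤ ε := by
        have h4 : |c - a| * (c + a) ≤ ε := by
          rw [← abs_of_nonneg (by positivity : 0 ≤ c + a), ← abs_mul, abs_sub_comm] at *
          have : (c - a) * (c + a) = -(M - c ^ 2) := by rw [← ha2]; ring
          rwa [this, abs_neg, abs_sub_comm]
        have h5 : c * a - M = (c - a) * a := by rw [← ha2]; ring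
        rw [h5, abs_mul, abs_of_nonneg ha0]
        nlinarith [abs_nonneg (c - a)]
      rw [hdec]
      refine (norm_add_le _ _).trans ?_
      rw [norm_smul, hv, mul_one, Real.norm_eq_abs]
      linarith
    rw [norm_smul, Real.norm_of_nonneg hc] at h1
    have h2 : ‖θ‖ / 2 * ‖a • v - θ‖ ≤ 4 * ε := by
      refine le_trans ?_ h1
      gcongr
    have : ‖a • v - θ‖ * ‖θ‖ ≤ 10 * ε := by linarith
    rw [← mul_div_assoc, le_div_iff₀ hT]
    exact this

end LinearAlgebra

/-- The supremum of the Rayleigh quotient is itself an eigenvalue, and the set of eigenvalues is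
finite, hence bounded above, so the `sSup` in `lambdaMax` dominates it. -/
theorem inner_toEuclideanLin_le_lambdaMax {d : ℕ} {A : Matrix (Fin d) (Fin d) ℝ}
    (hA : (Matrix.toEuclideanLin A).IsSymmetric) (u : EuclideanSpace ℝ (Fin d)) :
    inner ℝ (Matrix.toEuclideanLin A u) u ≤ lambdaMax A * ‖u‖ ^ 2 := by
  by_cases hu : u = 0
  · simp [hu]
  have : Nontrivial (EuclideanSpace ℝ (Fin d)) := ⟨u, 0, hu⟩
  set T := Matrix.toEuclideanLin A
  have hE := hA.hasEigenvalue_iSup_of_finiteDimensional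
  have hle := le_csSup (Module.End.finite_hasEigenvalue (f := T)).bddAbove hE
  have hu0 : 0 < ‖u‖ := norm_pos_iff.2 hu
  rw [← div_le_iff₀ (by positivity)]
  refine le_trans ?_ hle
  refine le_ciSup (f := fun x : { x : EuclideanSpace ℝ (Fin d) // x ≠ 0 } =>
      RCLike.re (inner ℝ (T x) (x : EuclideanSpace ℝ (Fin d))) /
        ‖(x : EuclideanSpace ℝ (Fin d))‖ ^ 2) ⟨‖T.toContinuousLinearMap‖, ?_⟩ ⟨u, hu⟩
  rintro _ ⟨x, rfl⟩
  have hx0 : 0 < ‖(x : EuclideanSpace ℝ (Fin d))‖ := norm_pos_iff.2 x.2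
  simp only
  rw [div_le_iff₀ (by positivity)]
  calc RCLike.re (inner ℝ (T x) (x : EuclideanSpace ℝ (Fin d)))
      ≤ ‖T x‖ * ‖(x : EuclideanSpace ℝ (Fin d))‖ :=
        real_inner_le_norm (T x) (x : EuclideanSpace ℝ (Fin d))
    _ ≤ ‖T.toContinuousLinearMap‖ * ‖(x : EuclideanSpace ℝ (Fin d))‖ *
        ‖(x : EuclideanSpace ℝ (Fin d))‖ := by
      gcongr; exact T.toContinuousLinearMap.le_opNorm x
    _ = _ := by ring

/-! ### Exponential moments of sub-Gaussian variables and their squares -/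

section Concentration

variable {Ω : Type*} [MeasurableSpace Ω] {P : Measure Ω}

/-- From `1 + t m ≤ E exp(tX) ≤ exp(c t²/2)`, the difference of the outer terms is minimal at `t =
0`, so its derivative `-m` there vanishes. The noise model does not postulate centring; this
supplies it. -/
theorem ProbabilityTheory.HasSubgaussianMGF.integral_eq_zero [IsProbabilityMeasure P] {X : Ω → ℝ}
    {c : NNReal} (h : HasSubgaussianMGF X c P) : ∫ ω, X ω ∂P = 0 := by
  set m := ∫ ω, X ω ∂P with hm
  have hle : ∀ t : ℝ, 0 ≤ Real.exp (c * t ^ 2 / 2) - (t * m + 1) := by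
    intro t
    have h1 : ∫ ω, (t * X ω + 1) ∂P ≤ mgf X P t :=
      integral_mono ((h.integrable.const_mul t).add (integrable_const 1))
        (h.integrable_exp_mul t) fun ω => Real.add_one_le_exp _
    rw [integral_add (h.integrable.const_mul t) (integrable_const 1), integral_const_mul] at h1
    simp only [integral_const, probReal_univ, smul_eq_mul, mul_one] at h1
    linarith [h.mgf_le t]
  have hder : HasDerivAt (fun t : ℝ => Real.exp (c * t ^ 2 / 2) - (t * m + 1)) (-m) 0 := by
    have h1 : HasDerivAt (fun t : ℝ => (c : ℝ) * t ^ 2 / 2) 0 0 := by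
      have := ((hasDerivAt_pow 2 (0 : ℝ)).const_mul (c : ℝ)).div_const 2
      simpa using this
    have h2 := h1.exp.fun_sub (((hasDerivAt_id (0 : ℝ)).mul_const m).add_const 1)
    simpa using! h2
  have hmin : IsLocalMin (fun t : ℝ => Real.exp (c * t ^ 2 / 2) - (t * m + 1)) 0 := by
    refine Filter.Eventually.of_forall fun t => ?_
    simpa using hle t
  have := hmin.hasDerivAt_eq_zero hder
  linarith

/-- The square of a sub-Gaussian variable has a finite exponential moment. -/
theorem ProbabilityTheory.HasSubgaussianMGF.exp_sq_div_four [IsProbabilityMeasure P] {X : Ω → ℝ}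
    (h : HasSubgaussianMGF X 1 P) :
    Integrable (fun ω => Real.exp (X ω ^ 2 / 4)) P ∧ ∫ ω, Real.exp (X ω ^ 2 / 4) ∂P ≤ 2 := by
  -- Gaussian linearisation: the square in the exponent is written as an average of linear
  -- exponents, Tonelli brings the expectation over `X` inside, and what remains is `E exp(g²/4) =
  -- √2` for a standard Gaussian `g`.
  have hgauss : ∀ z : ℝ, ∫⁻ x, ENNReal.ofReal (Real.exp (x * (z / √2))) ∂(gaussianReal 0 1) =
      ENNReal.ofReal (Real.exp (z ^ 2 / 4)) := by
    intro z
    rw [← ofReal_integral_eq_lintegral_ofReal]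
    · have := congrFun (mgf_id_gaussianReal (μ := 0) (v := 1)) (z / √2)
      simp only [mgf, id] at this
      simp_rw [mul_comm _ (z / √2)]
      rw [this]
      congr 2
      simp [div_pow]; ring
    · have := integrable_exp_mul_gaussianReal (μ := 0) (v := 1) (z / √2)
      simpa [mul_comm] using this
    · exact ae_of_all _ fun _ => (Real.exp_pos _).le
  have hmeas : AEMeasurable X P := h.aemeasurable
  have hfin : ∫⁻ x, ENNReal.ofReal (Real.exp (x ^ 2 / 4)) ∂(gaussianReal 0 1) ≤ 2 := by
    rw [gaussianReal_of_var_ne_zero _ one_ne_zero,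
      lintegral_withDensity_eq_lintegral_mul _ (measurable_gaussianPDF 0 1) (by fun_prop)]
    have : ∀ x : ℝ, (gaussianPDF 0 1 * fun x => ENNReal.ofReal (Real.exp (x ^ 2 / 4))) x =
        ENNReal.ofReal ((√(2 * Real.pi))⁻¹ * Real.exp (-(1 / 4) * x ^ 2)) := by
      intro x
      simp only [Pi.mul_apply, gaussianPDF, gaussianPDFReal]
      rw [← ENNReal.ofReal_mul (by positivity)]
      congr 1
      simp only [NNReal.coe_one, mul_one, sub_zero]
      rw [mul_assoc, ← Real.exp_add]
      congr 2
      ring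
    simp_rw [this]
    rw [← ofReal_integral_eq_lintegral_ofReal
      ((integrable_exp_neg_mul_sq (by norm_num)).const_mul _)
      (ae_of_all _ fun _ => by positivity), integral_const_mul, integral_gaussian]
    rw [show Real.pi / (1 / 4) = 2 * (2 * Real.pi) by ring,
      Real.sqrt_mul zero_le_two (2 * Real.pi)]
    have hpos : 0 < √(2 * Real.pi) := by positivity
    have : (√(2 * Real.pi))⁻¹ * (√2 * √(2 * Real.pi)) = √2 := by field_simp
    rw [this]
    have h2 : √2 ≤ 2 := by
      rw [Real.sqrt_le_left (by norm_num)]; norm_num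
    calc ENNReal.ofReal √2 ≤ ENNReal.ofReal 2 := ENNReal.ofReal_le_ofReal h2
      _ = 2 := by simp
  have hlint : ∫⁻ ω, ENNReal.ofReal (Real.exp (X ω ^ 2 / 4)) ∂P ≤ 2 := by
    calc ∫⁻ ω, ENNReal.ofReal (Real.exp (X ω ^ 2 / 4)) ∂P
        = ∫⁻ ω, ∫⁻ x, ENNReal.ofReal (Real.exp (x * (X ω / √2))) ∂(gaussianReal 0 1) ∂P := by
          simp_rw [hgauss]
      _ = ∫⁻ x, ∫⁻ ω, ENNReal.ofReal (Real.exp (x * (X ω / √2))) ∂P ∂(gaussianReal 0 1) := by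
          apply lintegral_lintegral_swap
          simp only [Function.uncurry_def]
          have : AEMeasurable (fun p : Ω × ℝ => X p.1) (P.prod (gaussianReal 0 1)) :=
            hmeas.comp_fst
          fun_prop
      _ ≤ ∫⁻ x, ENNReal.ofReal (Real.exp (x ^ 2 / 4)) ∂(gaussianReal 0 1) := by
          refine lintegral_mono fun x => ?_
          have h1 : ∀ ω, x * (X ω / √2) = (x / √2) * X ω := fun ω => by ring
          simp_rw [h1]
          rw [← ofReal_integral_eq_lintegral_ofReal (h.integrable_exp_mul _)
            (ae_of_all _ fun _ => (Real.exp_pos _).le)]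
          refine ENNReal.ofReal_le_ofReal ((h.mgf_le _).trans_eq ?_)
          congr 1
          simp [div_pow]; ring
      _ ≤ 2 := hfin
  have hint : Integrable (fun ω => Real.exp (X ω ^ 2 / 4)) P := by
    refine ⟨by fun_prop, ?_⟩
    rw [hasFiniteIntegral_iff_ofReal (ae_of_all _ fun _ => (Real.exp_pos _).le)]
    exact hlint.trans_lt (by simp)
  refine ⟨hint, ?_⟩
  rw [integral_eq_lintegral_of_nonneg_ae (ae_of_all _ fun _ => (Real.exp_pos _).le) hint.1]
  exact ENNReal.toReal_le_of_le_ofReal (by norm_num) (by simpa using hlint)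

theorem Real.exp_le_one_add_add_sq_mul_exp_abs (x : ℝ) :
    Real.exp x ≤ 1 + x + x ^ 2 * Real.exp |x| := by
  have h1 : 1 ≤ Real.exp |x| := Real.one_le_exp (abs_nonneg x)
  rcases le_or_gt |x| 1 with h | h
  · have := (abs_le.1 (Real.abs_exp_sub_one_sub_id_le h)).2
    nlinarith [sq_nonneg x]
  · rcases le_total 0 x with hx | hx
    · rw [abs_of_nonneg hx] at *
      nlinarith [Real.exp_pos x, mul_pos (Real.exp_pos x) (by nlinarith : 0 < x ^ 2 - 1)]
    · rw [abs_of_nonpos hx] at *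
      have : Real.exp x ≤ 1 := Real.exp_le_one_iff.2 hx
      nlinarith

/-- The centred square of a sub-Gaussian variable is sub-exponential. -/
theorem ProbabilityTheory.HasSubgaussianMGF.mgf_sq_sub_one_le [IsProbabilityMeasure P] {X : Ω → ℝ}
    (h : HasSubgaussianMGF X 1 P) (hvar : ∫ ω, X ω ^ 2 ∂P = 1) {t : ℝ} (ht : |t| ≤ 1 / 8) :
    Integrable (fun ω => Real.exp (t * (X ω ^ 2 - 1))) P ∧
      mgf (fun ω => X ω ^ 2 - 1) P t ≤ Real.exp (768 * t ^ 2) := by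
  obtain ⟨hint, hle⟩ := h.exp_sq_div_four
  have hmeas : AEMeasurable X P := h.aemeasurable
  have hX2 : Integrable (fun ω => X ω ^ 2) P := (h.memLp 2).integrable_sq
  -- Half of `exp(x²/4)` absorbs `exp|t(x² - 1)|`, because `|t| ≤ 1/8`; the other half absorbs `(x²
  -- - 1)²` at the cost `256 = 16²`. With `exp(1/4) ≤ 3/2` this gives `384`, and the moment bound
  -- `2` then gives `768`. The linear term integrates to zero by unit variance.
  have hpt : ∀ x : ℝ, Real.exp (t * (x ^ 2 - 1)) ≤
      1 + t * (x ^ 2 - 1) + 384 * t ^ 2 * Real.exp (x ^ 2 / 4) := by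
    intro x
    refine (Real.exp_le_one_add_add_sq_mul_exp_abs _).trans ?_
    have hb : |x ^ 2 - 1| ≤ x ^ 2 + 1 := by
      rw [abs_le]; constructor <;> nlinarith [sq_nonneg x]
    have h1 : Real.exp |t * (x ^ 2 - 1)| ≤ Real.exp ((x ^ 2 + 1) / 8) := by
      rw [Real.exp_le_exp, abs_mul]
      nlinarith [abs_nonneg t, abs_nonneg (x ^ 2 - 1), sq_nonneg x]
    have h2 : (x ^ 2 - 1) ^ 2 ≤ 256 * Real.exp ((x ^ 2 + 1) / 8) := by
      have h3 : (x ^ 2 + 1) / 16 ≤ Real.exp ((x ^ 2 + 1) / 16) := by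
        linarith [Real.add_one_le_exp ((x ^ 2 + 1) / 16)]
      have h4 : Real.exp ((x ^ 2 + 1) / 8) = Real.exp ((x ^ 2 + 1) / 16) ^ 2 := by
        rw [← Real.exp_nat_mul]; congr 1; push_cast; ring
      have h5 : (x ^ 2 - 1) ^ 2 ≤ (x ^ 2 + 1) ^ 2 := by nlinarith [sq_nonneg x]
      rw [h4]
      nlinarith [sq_nonneg x]
    have h6 : Real.exp ((x ^ 2 + 1) / 8) * Real.exp ((x ^ 2 + 1) / 8) ≤
        3 / 2 * Real.exp (x ^ 2 / 4) := by
      rw [← Real.exp_add, show (x ^ 2 + 1) / 8 + (x ^ 2 + 1) / 8 = 1 / 4 + x ^ 2 / 4 by ring,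
        Real.exp_add]
      have : Real.exp (1 / 4) ≤ 3 / 2 := by
        have h7 := (abs_le.1 (Real.abs_exp_sub_one_sub_id_le (x := 1 / 4)
          (by norm_num [abs_of_pos]))).2
        norm_num at h7 ⊢
        linarith
      gcongr
    have h8 : (x ^ 2 - 1) ^ 2 * Real.exp |t * (x ^ 2 - 1)| ≤ 384 * Real.exp (x ^ 2 / 4) := by
      calc (x ^ 2 - 1) ^ 2 * Real.exp |t * (x ^ 2 - 1)|
          ≤ 256 * Real.exp ((x ^ 2 + 1) / 8) * Real.exp ((x ^ 2 + 1) / 8) := by gcongr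
        _ ≤ _ := by linarith
    have h9 := mul_le_mul_of_nonneg_left h8 (sq_nonneg t)
    rw [mul_pow]
    linarith
  have hXc : Integrable (fun ω => t * (X ω ^ 2 - 1)) P :=
    (hX2.sub (integrable_const 1)).const_mul t
  have hint2 : Integrable
      (fun ω => 1 + t * (X ω ^ 2 - 1) + 384 * t ^ 2 * Real.exp (X ω ^ 2 / 4)) P :=
    ((integrable_const 1).add hXc).add (hint.const_mul _)
  have hint3 : Integrable (fun ω => Real.exp (t * (X ω ^ 2 - 1))) P := by
    refine hint2.mono' (by fun_prop) (ae_of_all _ fun ω => ?_)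
    rw [Real.norm_of_nonneg (Real.exp_pos _).le]
    exact hpt _
  refine ⟨hint3, ?_⟩
  calc mgf (fun ω => X ω ^ 2 - 1) P t
      ≤ ∫ ω, (1 + t * (X ω ^ 2 - 1) + 384 * t ^ 2 * Real.exp (X ω ^ 2 / 4)) ∂P :=
        integral_mono hint3 hint2 fun ω => hpt _
    _ = 1 + 384 * t ^ 2 * ∫ ω, Real.exp (X ω ^ 2 / 4) ∂P := by
        rw [integral_add (f := fun ω => 1 + t * (X ω ^ 2 - 1))
          ((integrable_const 1).add hXc) (hint.const_mul _),
          integral_add (integrable_const 1) hXc, integral_const_mul, integral_const_mul,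
          integral_sub hX2 (integrable_const 1), hvar]
        simp
    _ ≤ 768 * t ^ 2 + 1 := by nlinarith [sq_nonneg t]
    _ ≤ _ := Real.add_one_le_exp _

/-- Sums of independent variables over disjoint blocks of indices are independent. -/
theorem ProbabilityTheory.iIndepFun.sum_fiber {ι κ : Type*} [Fintype ι] [DecidableEq κ]
    {X : ι → Ω → ℝ} (hX : iIndepFun X P) (hmeas : ∀ j, Measurable (X j)) (b : ι → κ) :
    iIndepFun (fun i ω => ∑ j ∈ Finset.univ.filter (fun j => b j = i), X j ω) P := by
  classical
  have := hX.isProbabilityMeasure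
  rw [iIndepFun_iff_measure_inter_preimage_eq_mul]
  intro S
  induction S using Finset.induction_on with
  | empty => intro sets _; simp
  | insert a S ha ih =>
    intro sets hsets
    have ih' := ih (fun i hi => hsets i (Finset.mem_insert_of_mem hi))
    rw [Finset.prod_insert ha, ← ih']
    set T₁ := Finset.univ.filter (fun j => b j = a)
    set T₂ := Finset.univ.filter (fun j => b j ∈ S)
    have hdisj : Disjoint T₁ T₂ := by
      rw [Finset.disjoint_left]
      intro j h1 h2
      simp only [T₁, T₂, Finset.mem_filter, Finset.mem_univ, true_and] at h1 h2
      exact ha (h1 ▸ h2)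
    -- The block of `a` is disjoint from the union of the blocks in `S`, so it splits off as one
    -- independent factor.
    have hind := hX.indepFun_finset T₁ T₂ hdisj hmeas
    have hA : MeasurableSet {x : T₁ → ℝ | ∑ j, x j ∈ sets a} :=
      (Finset.univ.measurable_sum fun j _ => measurable_pi_apply j)
        (hsets a (Finset.mem_insert_self _ _))
    have hB : MeasurableSet (⋂ i ∈ S, {x : T₂ → ℝ |
        ∑ j ∈ Finset.univ.filter (fun j : T₂ => b j = i), x j ∈ sets i}) := by
      refine Finset.measurableSet_biInter _ fun i hi => ?_
      exact (Finset.measurable_sum _ fun j _ => measurable_pi_apply j)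
        (hsets i (Finset.mem_insert_of_mem hi))
    have hmul := hind.measure_inter_preimage_eq_mul _ _ hA hB
    have e1 : (fun ω (j : T₁) => X j ω) ⁻¹' {x : T₁ → ℝ | ∑ j, x j ∈ sets a} =
        (fun ω => ∑ j ∈ T₁, X j ω) ⁻¹' sets a := by
      ext ω
      simp only [Set.mem_preimage, Set.mem_ofPred_eq]
      rw [Finset.sum_coe_sort T₁ (fun j => X j ω)]
    have e2 : (fun ω (j : T₂) => X j ω) ⁻¹' (⋂ i ∈ S, {x : T₂ → ℝ |
        ∑ j ∈ Finset.univ.filter (fun j : T₂ => b j = i), x j ∈ sets i}) =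
        ⋂ i ∈ S, (fun ω => ∑ j ∈ Finset.univ.filter (fun j => b j = i), X j ω) ⁻¹' sets i := by
      ext ω
      simp only [Set.mem_preimage, Set.mem_iInter, Set.mem_ofPred_eq]
      refine forall₂_congr fun i hi => ?_
      have : ∑ j ∈ Finset.univ.filter (fun j : T₂ => b j = i), X j ω =
          ∑ j ∈ Finset.univ.filter (fun j => b j = i), X j ω := by
        rw [Finset.sum_filter, Finset.sum_coe_sort T₂ (fun j => if b j = i then X j ω else 0),
          ← Finset.sum_filter]
        congr 1
        ext j
        simp only [T₂, Finset.mem_filter, Finset.mem_univ, true_and, and_iff_right_iff_imp]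
        rintro rfl; exact hi
      rw [this]
    rw [e1, e2] at hmul
    rw [← hmul, Finset.set_biInter_insert]

end Concentration

/-! ### Tail bounds in a fixed direction -/

section Tails

variable {Ω : Type*} [MeasurableSpace Ω] {P : Measure Ω}

/-- Bernstein-type tail bound for the sum of centred squares of independent sub-Gaussian
variables. -/
theorem ProbabilityTheory.iIndepFun.measureReal_abs_sum_sq_sub_one_ge_le [IsProbabilityMeasure P]
    {l : ℕ} {Z : Fin l → Ω → ℝ} (hl : 1 ≤ l) (hZ : iIndepFun Z P) (hmeas : ∀ i, Measurable (Z i))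
    (hsub : ∀ i, HasSubgaussianMGF (Z i) 1 P) (hvar : ∀ i, ∫ ω, Z i ω ^ 2 ∂P = 1) (d : ℕ) :
    P.real {ω | 128 * (√((d : ℝ) * l) + d) ≤ |∑ i, (Z i ω ^ 2 - 1)|} ≤
      2 * Real.exp (-4 * d) := by
  set D : ℝ := (d : ℝ) with hD
  set L : ℝ := (l : ℝ) with hLdef
  have hD0 : 0 ≤ D := Nat.cast_nonneg d
  have hL : 1 ≤ L := by rw [hLdef]; exact_mod_cast hl
  have hS0 : 0 ≤ √(D * L) := Real.sqrt_nonneg _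
  have hSsq : √(D * L) ^ 2 = D * L := Real.sq_sqrt (by positivity)
  -- The Chernoff parameter is `min(√(D/L), 1) / 8`, capped by the range where the moment bound
  -- holds. The exponent is then at most `-16 D + 12 D = -4 D`.
  obtain ⟨a, ha0, ha8, ha1, ha2⟩ : ∃ a : ℝ, 0 ≤ a ∧ a ≤ 1 / 8 ∧
      16 * D ≤ a * (128 * (√(D * L) + D)) ∧ 768 * a ^ 2 * L ≤ 12 * D := by
    rcases le_total D L with h | h
    · refine ⟨√(D * L) / L / 8, by positivity, ?_, ?_, ?_⟩
      · have : √(D * L) / L ≤ 1 := by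
          rw [div_le_one (by linarith), Real.sqrt_le_left (by linarith)]
          nlinarith
        linarith
      · have h1 : √(D * L) / L / 8 * (128 * √(D * L)) = 16 * D := by
          field_simp
          linear_combination 128 * hSsq
        have h2 : 0 ≤ √(D * L) / L / 8 * (128 * D) := by positivity
        linarith
      · have : 768 * (√(D * L) / L / 8) ^ 2 * L = 12 * D := by
          field_simp
          linear_combination 768 * hSsq
        exact this.le
    · refine ⟨1 / 8, by norm_num, le_rfl, by linarith, by linarith⟩
  set W : Fin l → Ω → ℝ := fun i ω => Z i ω ^ 2 - 1 with hW
  have hWind : iIndepFun W P :=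
    hZ.comp (fun _ x => x ^ 2 - 1) fun _ => by fun_prop
  have hWmeas : ∀ i, Measurable (W i) := fun i => by
    have := hmeas i
    fun_prop
  have key : ∀ t : ℝ, |t| ≤ 1 / 8 → Integrable (fun ω => Real.exp (t * (∑ i, W i) ω)) P ∧
      mgf (∑ i, W i) P t ≤ Real.exp (768 * t ^ 2 * L) := by
    intro t ht
    refine ⟨hWind.integrable_exp_mul_sum hWmeas
      fun i _ => ((hsub i).mgf_sq_sub_one_le (hvar i) ht).1, ?_⟩
    rw [hWind.mgf_sum hWmeas]
    calc ∏ i, mgf (W i) P t ≤ ∏ _i : Fin l, Real.exp (768 * t ^ 2) :=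
          Finset.prod_le_prod (fun _ _ => mgf_nonneg)
            fun i _ => ((hsub i).mgf_sq_sub_one_le (hvar i) ht).2
      _ = _ := by
          rw [Finset.prod_const, Finset.card_univ, Fintype.card_fin, ← Real.exp_nat_mul]
          congr 1; rw [hLdef]; ring
  set τ := 128 * (√(D * L) + D) with hτ
  have hexp : Real.exp (-a * τ) * Real.exp (768 * a ^ 2 * L) ≤ Real.exp (-4 * D) := by
    rw [← Real.exp_add, Real.exp_le_exp]
    linarith
  have hup : P.real {ω | τ ≤ (∑ i, W i) ω} ≤ Real.exp (-4 * D) := by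
    obtain ⟨h1, h2⟩ := key a (by rwa [abs_of_nonneg ha0])
    refine (measure_ge_le_exp_mul_mgf τ ha0 h1).trans (le_trans ?_ hexp)
    gcongr
  have hlow : P.real {ω | (∑ i, W i) ω ≤ -τ} ≤ Real.exp (-4 * D) := by
    obtain ⟨h1, h2⟩ := key (-a) (by rwa [abs_neg, abs_of_nonneg ha0])
    refine (measure_le_le_exp_mul_mgf (-τ) (by linarith) h1).trans (le_trans ?_ hexp)
    rw [neg_sq] at h2
    rw [neg_neg, mul_neg, ← neg_mul]
    gcongr
  have hsubset : {ω | τ ≤ |∑ i, (Z i ω ^ 2 - 1)|} ⊆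
      {ω | τ ≤ (∑ i, W i) ω} ∪ {ω | (∑ i, W i) ω ≤ -τ} := by
    intro ω hω
    simp only [Set.mem_ofPred_eq, Set.mem_union, Finset.sum_apply, hW] at hω ⊢
    rcases le_abs.1 hω with h | h
    · exact Or.inl h
    · exact Or.inr (by linarith)
  calc P.real {ω | τ ≤ |∑ i, (Z i ω ^ 2 - 1)|}
      ≤ P.real ({ω | τ ≤ (∑ i, W i) ω} ∪ {ω | (∑ i, W i) ω ≤ -τ}) := measureReal_mono hsubset
    _ ≤ _ := measureReal_union_le _ _
    _ ≤ _ := by linarith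

/-- Hoeffding-type tail bound for bounded linear combinations of independent sub-Gaussian
variables. -/
theorem ProbabilityTheory.iIndepFun.measureReal_abs_linear_comb_ge_le [IsProbabilityMeasure P]
    {n : ℕ} {X : Fin n → Ω → ℝ} (hn : 1 ≤ n) (hX : iIndepFun X P)
    (hsub : ∀ j, HasSubgaussianMGF (X j) 1 P) {c : Fin n → ℝ} (hc : ∀ j, |c j| ≤ 1) (d : ℕ) :
    P.real {ω | 3 * √((d : ℝ) * n) ≤ |∑ j, c j * X j ω|} ≤ 2 * Real.exp (-4 * d) := by
  have hweak : ∀ j, HasSubgaussianMGF (fun ω => c j * X j ω) 1 P := fun j => by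
    refine ⟨((hsub j).const_mul (c j)).integrable_exp_mul, fun t => ?_⟩
    refine (((hsub j).const_mul (c j)).mgf_le t).trans ?_
    rw [Real.exp_le_exp]
    have h1 : c j ^ 2 ≤ 1 := (sq_le_one_iff_abs_le_one _).2 (hc j)
    have h2 : ((⟨c j ^ 2, sq_nonneg (c j)⟩ * 1 : NNReal) : ℝ) = c j ^ 2 := mul_one _
    rw [h2]
    simp only [NNReal.coe_one]
    gcongr
  have hind : iIndepFun (fun j ω => c j * X j ω) P :=
    hX.comp (fun j x => c j * x) fun _ => by fun_prop
  have hsum := HasSubgaussianMGF.sum_of_iIndepFun hind (s := Finset.univ) fun j _ => hweak j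
  have hτ : 0 ≤ 3 * √((d : ℝ) * n) := by positivity
  -- The exponent equals `-9d/2`; the factor `3` is chosen to beat `-4d`.
  have hexp : Real.exp (-(3 * √((d : ℝ) * n)) ^ 2 / (2 * ((∑ _j : Fin n, 1 : NNReal) : ℝ))) ≤
      Real.exp (-4 * d) := by
    rw [Real.exp_le_exp, mul_pow, Real.sq_sqrt (by positivity)]
    have hn' : (0 : ℝ) < n := by exact_mod_cast hn
    have hd : (0 : ℝ) ≤ d := Nat.cast_nonneg d
    simp only [Finset.sum_const, Finset.card_univ, Fintype.card_fin, nsmul_eq_mul, mul_one,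
      NNReal.coe_natCast]
    rw [div_le_iff₀ (by positivity)]
    nlinarith [mul_nonneg hd hn'.le]
  have hup := (hsum.measure_ge_le hτ).trans hexp
  have hlow := (hsum.neg.measure_ge_le hτ).trans hexp
  have hsubset : {ω | 3 * √((d : ℝ) * n) ≤ |∑ j, c j * X j ω|} ⊆
      {ω | 3 * √((d : ℝ) * n) ≤ ∑ j, c j * X j ω} ∪
        {ω | 3 * √((d : ℝ) * n) ≤ (-fun ω => ∑ j, c j * X j ω) ω} := by
    intro ω hω
    simpa only [Set.mem_ofPred_eq, le_abs] using! hω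
  refine (measureReal_mono hsubset).trans ((measureReal_union_le _ _).trans ?_)
  linarith

theorem IsSubGaussianVector.hasSubgaussianMGF_inner {d : ℕ} {X : Ω → EuclideanSpace ℝ (Fin d)}
    (h : IsSubGaussianVector P X) {y : EuclideanSpace ℝ (Fin d)} (hy : ‖y‖ = 1) :
    HasSubgaussianMGF (fun ω => inner ℝ y (X ω)) 1 P := by
  have h1 : ∀ (t : ℝ) ω, t * inner ℝ y (X ω) = inner ℝ (t • y) (X ω) := fun t ω => by
    rw [inner_smul_left]; rfl
  refine ⟨fun t => ?_, fun t => ?_⟩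
  · simp_rw [h1]; exact h.integrable_exp _
  · simp_rw [mgf, h1]
    refine (h.integral_exp_le _).trans_eq ?_
    rw [norm_smul, hy]
    simp

theorem IsIsotropicVector.integral_inner_sq [IsProbabilityMeasure P] {d : ℕ}
    {X : Ω → EuclideanSpace ℝ (Fin d)} (h : IsIsotropicVector P X) (hsub : IsSubGaussianVector P X)
    (y : EuclideanSpace ℝ (Fin d)) : ∫ ω, inner ℝ y (X ω) ^ 2 ∂P = ‖y‖ ^ 2 := by
  have hcoord : ∀ a : Fin d, MemLp (fun ω => X ω a) 2 P := fun a => by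
    have := (hsub.hasSubgaussianMGF_inner (y := EuclideanSpace.single a 1) (by simp)).memLp 2
    simpa [EuclideanSpace.inner_single_left] using this
  have hint : ∀ a b : Fin d, Integrable (fun ω => X ω a * X ω b) P :=
    fun a b => (hcoord a).integrable_mul (hcoord b)
  have hexpand : ∀ ω, inner ℝ y (X ω) ^ 2 = ∑ a, ∑ b, y a * y b * (X ω a * X ω b) := by
    intro ω
    rw [sq, PiLp.inner_apply, Finset.sum_mul_sum]
    refine Finset.sum_congr rfl fun a _ => Finset.sum_congr rfl fun b _ => ?_
    simp; ring
  simp_rw [hexpand]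
  rw [integral_finsetSum _ fun a _ => integrable_finsetSum _ fun b _ => (hint a b).const_mul _]
  have : ∀ a, ∫ ω, ∑ b, y a * y b * (X ω a * X ω b) ∂P = y a ^ 2 := by
    intro a
    rw [integral_finsetSum _ fun b _ => (hint a b).const_mul _]
    simp_rw [integral_const_mul, h a, Matrix.one_apply]
    simp [sq]
  simp_rw [this]
  rw [EuclideanSpace.norm_sq_eq]
  simp

theorem integral_sum_sq_of_iIndepFun [IsProbabilityMeasure P] {ι : Type*} {X : ι → Ω → ℝ}
    (hX : iIndepFun X P) (hsub : ∀ j, HasSubgaussianMGF (X j) 1 P)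
    (hvar : ∀ j, ∫ ω, X j ω ^ 2 ∂P = 1) (s : Finset ι) :
    ∫ ω, (∑ j ∈ s, X j ω) ^ 2 ∂P = s.card := by
  have hs := HasSubgaussianMGF.sum_of_iIndepFun hX (s := s) fun j _ => hsub j
  rw [← variance_of_integral_eq_zero hs.aemeasurable hs.integral_eq_zero]
  have h1 := IndepFun.variance_sum (s := s) (fun j _ => (hsub j).memLp 2)
    fun i _ j _ hij => hX.indepFun hij
  have h2 : (∑ j ∈ s, X j) = fun ω => ∑ j ∈ s, X j ω := by ext; simp
  rw [h2] at h1
  rw [h1]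
  have h3 : ∀ j ∈ s, variance (X j) P = 1 := fun j _ => by
    rw [variance_of_integral_eq_zero (hsub j).aemeasurable (hsub j).integral_eq_zero, hvar j]
  rw [Finset.sum_congr rfl h3]
  simp

theorem card_filter_div_eq {n k l : ℕ} (hk : 1 ≤ k) (hn : n = k * l) {i : ℕ} (hi : i < l) :
    (Finset.univ.filter (fun j : Fin n => (j : ℕ) / k = i)).card = k := by
  have h1 : (Finset.univ.filter (fun j : Fin n => (j : ℕ) / k = i)).map Fin.valEmbedding =
      Finset.Ico (i * k) (i * k + k) := by
    ext m
    simp only [Finset.mem_map, Finset.mem_filter, Finset.mem_univ, true_and, Fin.valEmbedding_apply,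
      Finset.mem_Ico]
    constructor
    · rintro ⟨j, hj, rfl⟩
      rw [Nat.div_eq_iff (by omega)] at hj
      omega
    · rintro ⟨h1, h2⟩
      have h3 : (i + 1) * k ≤ l * k := Nat.mul_le_mul_right k hi
      refine ⟨⟨m, ?_⟩, ?_, rfl⟩
      · rw [hn, mul_comm k l]
        rw [add_mul, one_mul] at h3
        omega
      · show m / k = i
        rw [Nat.div_eq_iff (by omega)]
        omega
  rw [← Finset.card_map Fin.valEmbedding, h1, Nat.card_Ico]
  omega

/-- Concentration of the quadratic form of the sample covariance of the bucket sums of a scalar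
noise. -/
theorem measureReal_abs_sum_bucket_sq_sub_ge_le [IsProbabilityMeasure P] {n k l : ℕ} (hk : 1 ≤ k)
    (hl : 1 ≤ l) (hn : n = k * l) {X : Fin n → Ω → ℝ} (hX : iIndepFun X P)
    (hmeas : ∀ j, Measurable (X j)) (hsub : ∀ j, HasSubgaussianMGF (X j) 1 P)
    (hvar : ∀ j, ∫ ω, X j ω ^ 2 ∂P = 1) (d : ℕ) :
    P.real {ω | 128 * (√((d : ℝ) * l) + d) * k ≤ |∑ i : Fin l,
      ((∑ j ∈ Finset.univ.filter (fun j : Fin n => (j : ℕ) / k = i), X j ω) ^ 2 - k)|} ≤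
      2 * Real.exp (-4 * d) := by
  have hk0 : (0 : ℝ) < k := by exact_mod_cast hk
  have hsq : √(k : ℝ) ^ 2 = k := Real.sq_sqrt hk0.le
  set U : ℕ → Ω → ℝ := fun i ω =>
    ∑ j ∈ Finset.univ.filter (fun j : Fin n => (j : ℕ) / k = i), X j ω with hU
  have hUind : iIndepFun U P := hX.sum_fiber hmeas fun j : Fin n => (j : ℕ) / k
  -- Dividing by `√k` restores unit variance and sub-Gaussian parameter `1`, because each bucket has
  -- exactly `k` indices.
  set Z : Fin l → Ω → ℝ := fun i ω => (√(k : ℝ))⁻¹ * U i ω with hZ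
  have hZind : iIndepFun Z P :=
    (hUind.precomp Fin.val_injective).comp (fun _ x => (√(k : ℝ))⁻¹ * x) fun _ => by fun_prop
  have hZmeas : ∀ i, Measurable (Z i) := fun i =>
    (Finset.measurable_sum _ fun j _ => hmeas j).const_mul _
  have hZsub : ∀ i, HasSubgaussianMGF (Z i) 1 P := fun i => by
    have h1 := (HasSubgaussianMGF.sum_of_iIndepFun hX
      (s := Finset.univ.filter (fun j : Fin n => (j : ℕ) / k = i))
      fun j _ => hsub j).const_mul (√(k : ℝ))⁻¹
    have h2 : (⟨(√(k : ℝ))⁻¹ ^ 2, sq_nonneg _⟩ * ∑ _j ∈ Finset.univ.filter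
        (fun j : Fin n => (j : ℕ) / k = i), 1 : NNReal) = 1 := by
      rw [Finset.sum_const, card_filter_div_eq hk hn i.2]
      ext
      change (√(k : ℝ))⁻¹ ^ 2 * ((k • (1 : NNReal) : NNReal) : ℝ) = 1
      rw [inv_pow, hsq]
      simp [hk0.ne']
    rw [h2] at h1
    exact h1
  have hZvar : ∀ i, ∫ ω, Z i ω ^ 2 ∂P = 1 := fun i => by
    simp only [hZ, mul_pow]
    rw [integral_const_mul, hU, integral_sum_sq_of_iIndepFun hX hsub hvar,
      card_filter_div_eq hk hn i.2, inv_pow, hsq]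
    field_simp
  have := hZind.measureReal_abs_sum_sq_sub_one_ge_le hl hZmeas hZsub hZvar d
  convert this using 4 with ω
  have h3 : ∑ i : Fin l, (Z i ω ^ 2 - 1) = (∑ i : Fin l, (U i ω ^ 2 - k)) / k := by
    rw [Finset.sum_div]
    refine Finset.sum_congr rfl fun i _ => ?_
    simp only [hZ, mul_pow, inv_pow, hsq]
    field_simp
  rw [h3, abs_div, abs_of_pos hk0, le_div_iff₀ hk0]

/-- A tail bound that holds for every value of a variable in a set holds after substituting an
independent random variable with values in that set. -/
theorem ProbabilityTheory.IndepFun.measure_le_of_forall [IsProbabilityMeasure P] {α β : Type*}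
    [MeasurableSpace α] [MeasurableSpace β] {f : Ω → α} {g : Ω → β} (h : IndepFun f g P)
    (hf : Measurable f) (hg : Measurable g) {S : Set α} (hS : MeasurableSet S)
    (hfS : ∀ ω, f ω ∈ S) {B : Set (α × β)} (hB : MeasurableSet B) {p : ENNReal}
    (hp : ∀ s ∈ S, P {ω | (s, g ω) ∈ B} ≤ p) : P {ω | (f ω, g ω) ∈ B} ≤ p := by
  have h1 : P {ω | (f ω, g ω) ∈ B} = (P.map fun ω => (f ω, g ω)) B :=
    (Measure.map_apply (hf.prodMk hg) hB).symm
  have : IsProbabilityMeasure (P.map f) := Measure.isProbabilityMeasure_map hf.aemeasurable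
  have : IsProbabilityMeasure (P.map g) := Measure.isProbabilityMeasure_map hg.aemeasurable
  rw [h1, (indepFun_iff_map_prod_eq_prod_map_map hf.aemeasurable hg.aemeasurable).1 h,
    Measure.prod_apply hB]
  have hae : ∀ᵐ s ∂(P.map f), s ∈ S :=
    (ae_map_iff hf.aemeasurable hS).2 (ae_of_all _ hfS)
  calc ∫⁻ s, (P.map g) (Prod.mk s ⁻¹' B) ∂(P.map f) ≤ ∫⁻ _s, p ∂(P.map f) := by
        refine lintegral_mono_ae (hae.mono fun s hs => ?_)
        rw [Measure.map_apply hg (measurable_prodMk_left hB)]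
        exact hp s hs
    _ = p := by simp

end Tails

/-! ### The number of flips of the chain -/

section Flips

/-- The times at which the path `s` changes its value at the next step. -/
noncomputable def flipSet {n : ℕ} (s : Fin n → ℝ) : Finset (Fin n) :=
  open Classical in Finset.univ.filter fun j => ∃ h : (j : ℕ) + 1 < n, s ⟨j + 1, h⟩ ≠ s j

/-- The number of flips of the path `s` before time `m`. -/
noncomputable def flipCount {n : ℕ} (s : Fin n → ℝ) (m : ℕ) : ℕ :=
  ((flipSet s).filter fun j : Fin n => (j : ℕ) < m).card

theorem mem_flipSet {n : ℕ} {s : Fin n → ℝ} {j : Fin n} :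
    j ∈ flipSet s ↔ ∃ h : (j : ℕ) + 1 < n, s ⟨j + 1, h⟩ ≠ s j := by
  simp [flipSet]

theorem flipCount_zero {n : ℕ} (s : Fin n → ℝ) : flipCount s 0 = 0 := by
  simp [flipCount]

theorem flipCount_succ {n : ℕ} (s : Fin n → ℝ) {i j : Fin n} (hij : (j : ℕ) = i + 1) :
    flipCount s (i + 1) = flipCount s i + if s j ≠ s i then 1 else 0 := by
  classical
  have hj : ∀ h : (i : ℕ) + 1 < n, (⟨i + 1, h⟩ : Fin n) = j := fun h => Fin.ext hij.symm
  have hi : i ∈ flipSet s ↔ s j ≠ s i := by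
    rw [mem_flipSet]
    constructor
    · rintro ⟨h, h'⟩; rwa [hj h] at h'
    · intro h'
      have h : (i : ℕ) + 1 < n := hij ▸ j.2
      exact ⟨h, by rwa [hj h]⟩
  unfold flipCount
  split_ifs with h
  · have : (flipSet s).filter (fun r : Fin n => (r : ℕ) < i + 1) =
        insert i ((flipSet s).filter fun r : Fin n => (r : ℕ) < i) := by
      ext r
      simp only [Finset.mem_filter, Finset.mem_insert, Nat.lt_succ_iff_lt_or_eq]
      constructor
      · rintro ⟨h1, h2 | h2⟩
        exacts [Or.inr ⟨h1, h2⟩, Or.inl (Fin.ext h2)]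
      · rintro (rfl | ⟨h1, h2⟩)
        exacts [⟨hi.2 h, Or.inr rfl⟩, ⟨h1, Or.inl h2⟩]
    rw [this, Finset.card_insert_of_notMem (by simp)]
  · rw [add_zero]
    congr 1
    ext r
    simp only [Finset.mem_filter, Nat.lt_succ_iff_lt_or_eq]
    constructor
    · rintro ⟨h1, h2 | h2⟩
      · exact ⟨h1, h2⟩
      · exact absurd (hi.1 (Fin.ext h2 ▸ h1)) h
    · rintro ⟨h1, h2⟩
      exact ⟨h1, Or.inl h2⟩

/-- A flip recorded at `r < i` involves only times `r` and `r + 1 ≤ i`. This makes the count a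
function of the past, as the one-step identity requires. -/
theorem flipCount_congr {n : ℕ} {s s' : Fin n → ℝ} {i : Fin n} (h : ∀ r, r ≤ i → s r = s' r) :
    flipCount s i = flipCount s' i := by
  unfold flipCount
  congr 1
  ext r
  simp only [Finset.mem_filter, mem_flipSet, and_congr_left_iff]
  intro hr
  refine exists_congr fun h' => ?_
  rw [h r (Fin.le_def.2 hr.le), h ⟨r + 1, h'⟩ (Fin.le_def.2 hr)]

theorem flipCount_last {n : ℕ} (s : Fin n → ℝ) (hn : 1 ≤ n) :
    flipCount s (n - 1) = (flipSet s).card := by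
  unfold flipCount
  congr 1
  refine Finset.filter_true_of_mem fun r hr => ?_
  obtain ⟨h, -⟩ := mem_flipSet.1 hr
  omega

variable {Ω : Type*} [MeasurableSpace Ω] {P : Measure Ω} {n : ℕ} {δ : ℝ} {η : Fin n → Ω → ℝ}

/-- A flip of the chain has probability `δ` given the past. -/
theorem IsSymmetricSignChain.integral_past_mul_flip [IsProbabilityMeasure P]
    (hη : IsSymmetricSignChain P δ η) {i j : Fin n} (hij : (j : ℕ) = i + 1)
    {h : (Fin n → ℝ) → ℝ} (hdep : ∀ s s', (∀ r, r ≤ i → s r = s' r) → h s = h s') :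
    Integrable (fun ω => h fun r => η r ω) P ∧
    Integrable (fun ω => if η j ω ≠ η i ω then h fun r => η r ω else 0) P ∧
    ∫ ω, (if η j ω ≠ η i ω then h fun r => η r ω else 0) ∂P =
      δ * ∫ ω, h (fun r => η r ω) ∂P := by
  classical
  -- One representative for each history up to time `i`, with later coordinates frozen at `1`; the
  -- corresponding cylinders partition `Ω`.
  set S : Finset (Fin n → ℝ) := Fintype.piFinset fun r => if r ≤ i then {1, -1} else {1} with hS
  set cyl : (Fin n → ℝ) → Set Ω := fun s => {ω | ∀ r, r ≤ i → η r ω = s r} with hcyl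
  set fl : Set Ω := {ω | η j ω ≠ η i ω} with hfl
  have hcylm : ∀ s, MeasurableSet (cyl s) := fun s => by
    have : cyl s = ⋂ r, ⋂ (_ : r ≤ i), {ω | η r ω = s r} := by
      ext; simp [hcyl]
    rw [this]
    exact MeasurableSet.iInter fun r => MeasurableSet.iInter fun _ =>
      hη.measurable r (measurableSet_singleton _)
  have hflm : MeasurableSet fl :=
    (measurableSet_eq_fun (hη.measurable j) (hη.measurable i)).compl
  have hsign : ∀ s ∈ S, ∀ r, s r = 1 ∨ s r = -1 := fun s hs r => by
    have := Fintype.mem_piFinset.1 hs r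
    split_ifs at this <;> simp at this <;> tauto
  have hdecomp : ∀ (A : Set Ω) ω, A.indicator (fun ω => h fun r => η r ω) ω =
      ∑ s ∈ S, (cyl s ∩ A).indicator (fun _ => h s) ω := by
    intro A ω
    by_cases hA : ω ∈ A
    · rw [Set.indicator_of_mem hA]
      set s₀ : Fin n → ℝ := fun r => if r ≤ i then η r ω else 1 with hs₀
      have hs₀S : s₀ ∈ S := by
        rw [hS, Fintype.mem_piFinset]
        intro r
        simp only [hs₀]
        split_ifs
        · rcases hη.sign r ω with h' | h' <;> simp [h']
        · simp
      have hmem : ω ∈ cyl s₀ := fun r hr => by simp [hs₀, hr]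
      rw [Finset.sum_eq_single_of_mem s₀ hs₀S]
      · rw [Set.indicator_of_mem (Set.mem_inter hmem hA)]
        exact hdep _ _ fun r hr => hmem r hr
      · intro s hs hne
        refine Set.indicator_of_notMem (fun hω => hne ?_) _
        ext r
        by_cases hr : r ≤ i
        · rw [← hω.1 r hr, hmem r hr]
        · have h1 := Fintype.mem_piFinset.1 hs r
          rw [if_neg hr, Finset.mem_singleton] at h1
          rw [h1, hs₀]
          simp [hr]
    · rw [Set.indicator_of_notMem hA]
      refine (Finset.sum_eq_zero fun s _ => Set.indicator_of_notMem (fun hω => hA hω.2) _).symm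
  have hI : ∀ A, MeasurableSet A →
      Integrable (A.indicator fun ω => h fun r => η r ω) P ∧
      ∫ ω, A.indicator (fun ω => h fun r => η r ω) ω ∂P = ∑ s ∈ S, P.real (cyl s ∩ A) * h s := by
    intro A hA
    have hint : ∀ s ∈ S, Integrable ((cyl s ∩ A).indicator fun _ => h s) P := fun s _ =>
      (integrable_const _).indicator ((hcylm s).inter hA)
    have heq := funext (hdecomp A)
    constructor
    · rw [heq]
      exact integrable_finsetSum _ hint
    · rw [heq, integral_finsetSum _ hint]
      refine Finset.sum_congr rfl fun s _ => ?_
      rw [integral_indicator_const _ ((hcylm s).inter hA), smul_eq_mul]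
  have hflip : ∀ s ∈ S, P.real (cyl s ∩ fl) = δ * P.real (cyl s) := by
    intro s hs
    have hne : ∀ r, r ≤ i → r ≠ j := fun r hr h' => by
      rw [h', Fin.le_def] at hr; omega
    set s' := Function.update s j (-s i) with hs'
    have hs'r : ∀ r, r ≤ i → s' r = s r := fun r hr => Function.update_of_ne (hne r hr) _ _
    have hs'j : s' j = -s i := Function.update_self _ _ _
    have hs'sign : ∀ r, s' r = 1 ∨ s' r = -1 := fun r => by
      by_cases hr : r = j
      · rw [hr, hs'j]
        rcases hsign s hs i with h' | h' <;> rw [h'] <;> simp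
      · rw [hs', Function.update_of_ne hr]
        exact hsign s hs r
    have hstep := hη.step i j hij s' hs'sign
    have hsi : s' j ≠ s' i := by
      rw [hs'j, hs'r i le_rfl]
      rcases hsign s hs i with h' | h' <;> rw [h'] <;> norm_num
    rw [if_neg hsi] at hstep
    have e1 : {ω | ∀ r, r ≤ i → η r ω = s' r} = cyl s := by
      ext ω
      exact forall₂_congr fun r hr => by rw [hs'r r hr]
    have e2 : {ω | ∀ r, r ≤ j → η r ω = s' r} = cyl s ∩ fl := by
      ext ω
      simp only [hcyl, hfl, Set.mem_ofPred_eq, Set.mem_inter_iff]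
      have hle : i ≤ j := Fin.le_def.2 (by omega)
      constructor
      · intro hω
        refine ⟨fun r hr => (hω r (hr.trans hle)).trans (hs'r r hr), ?_⟩
        rw [hω j le_rfl, hω i hle]
        exact hsi
      · rintro ⟨h1, h2⟩ r hr
        by_cases hrj : r = j
        · rw [hrj, hs'j]
          rw [h1 i le_rfl] at h2
          rcases hsign s hs i with h' | h' <;> rcases hη.sign j ω with h'' | h'' <;>
            first
              | exact absurd (h''.trans h'.symm) h2
              | rw [h', h''] <;> norm_num
        · have hri : r ≤ i := by
            rw [Fin.le_def] at hr ⊢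
            have : (r : ℕ) ≠ j := fun h' => hrj (Fin.ext h')
            omega
          rw [h1 r hri, hs'r r hri]
    rw [← e2, ← e1]
    exact hstep
  have hu := hI Set.univ MeasurableSet.univ
  have hf := hI fl hflm
  simp only [Set.indicator_univ, Set.inter_univ] at hu
  have hfe : (fun ω => if η j ω ≠ η i ω then h fun r => η r ω else 0) =
      fl.indicator fun ω => h fun r => η r ω := by
    ext ω
    simp [Set.indicator_apply, hfl]
  refine ⟨hu.1, ?_, ?_⟩
  · rw [hfe]; exact hf.1
  · rw [hfe, hf.2, hu.2, Finset.mul_sum]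
    exact Finset.sum_congr rfl fun s hs => by rw [hflip s hs, mul_assoc]

/-- Each transition multiplies the exponential moment by `1 + (e - 1)δ ≤ exp(2δ)`. -/
theorem IsSymmetricSignChain.integral_exp_flipCount_le [IsProbabilityMeasure P] (hδ : 0 ≤ δ)
    (hη : IsSymmetricSignChain P δ η) (m : ℕ) (hm : m < n) :
    Integrable (fun ω => Real.exp (flipCount (fun r => η r ω) m)) P ∧
      ∫ ω, Real.exp (flipCount (fun r => η r ω) m) ∂P ≤ Real.exp (2 * δ * m) := by
  induction m with
  | zero => simp [flipCount_zero]
  | succ m ih =>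
    obtain ⟨-, ih⟩ := ih (by omega)
    set i : Fin n := ⟨m, by omega⟩ with hi
    set j : Fin n := ⟨m + 1, hm⟩ with hj
    have hij : (j : ℕ) = i + 1 := rfl
    obtain ⟨h1, h2, h3⟩ := hη.integral_past_mul_flip hij
      (h := fun s => Real.exp (flipCount s i)) fun s s' hs => by rw [flipCount_congr hs]
    have hpt : (fun ω => Real.exp (flipCount (fun r => η r ω) (m + 1))) = fun ω =>
        Real.exp (flipCount (fun r => η r ω) i) + (Real.exp 1 - 1) *
          if η j ω ≠ η i ω then Real.exp (flipCount (fun r => η r ω) i) else 0 := by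
      ext ω
      rw [show m + 1 = (i : ℕ) + 1 from rfl, flipCount_succ (fun r => η r ω) hij]
      split_ifs
      · push_cast
        rw [Real.exp_add]
        ring
      · simp
    rw [hpt]
    refine ⟨h1.add (h2.const_mul _), ?_⟩
    rw [integral_add h1 (h2.const_mul _), integral_const_mul, h3]
    set G := ∫ ω, Real.exp (flipCount (fun r => η r ω) i) ∂P with hG
    have hG0 : 0 ≤ G := integral_nonneg fun _ => (Real.exp_pos _).le
    have he : Real.exp 1 - 1 ≤ 2 := by linarith [Real.exp_one_lt_d9]
    calc G + (Real.exp 1 - 1) * (δ * G) ≤ (2 * δ + 1) * G := by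
          nlinarith [mul_nonneg hδ hG0]
      _ ≤ Real.exp (2 * δ) * Real.exp (2 * δ * m) := by
          gcongr
          · exact Real.add_one_le_exp _
      _ = _ := by
          rw [← Real.exp_add]
          congr 1
          push_cast
          ring

theorem IsSymmetricSignChain.measureReal_card_flipSet_ge_le [IsProbabilityMeasure P] (hδ : 0 ≤ δ)
    (hη : IsSymmetricSignChain P δ η) (hn : 1 ≤ n) (t : ℝ) :
    P.real {ω | 2 * δ * n + t ≤ (flipSet fun r => η r ω).card} ≤ Real.exp (-t) := by
  obtain ⟨h1, h2⟩ := hη.integral_exp_flipCount_le hδ (n - 1) (by omega)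
  simp_rw [flipCount_last _ hn] at h1 h2
  have h3 := measure_ge_le_exp_mul_mgf (μ := P)
    (X := fun ω => ((flipSet fun r => η r ω).card : ℝ)) (t := 1) (2 * δ * n + t) zero_le_one
    (by simpa using h1)
  refine h3.trans ?_
  have h4 : mgf (fun ω => ((flipSet fun r => η r ω).card : ℝ)) P 1 ≤ Real.exp (2 * δ * n) := by
    simp only [mgf, one_mul]
    refine h2.trans (Real.exp_le_exp.2 ?_)
    have : ((n - 1 : ℕ) : ℝ) ≤ n := by exact_mod_cast Nat.sub_le n 1
    gcongr
  calc Real.exp (-1 * (2 * δ * n + t)) * mgf (fun ω => ((flipSet fun r => η r ω).card : ℝ)) P 1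
      ≤ Real.exp (-1 * (2 * δ * n + t)) * Real.exp (2 * δ * n) := by gcongr
    _ = Real.exp (-t) := by rw [← Real.exp_add]; congr 1; ring

end Flips

/-! ### Label averages over buckets -/

section BucketAverages

/-- The average of the labels over the `i`-th bucket. -/
noncomputable def bucketAvg {n : ℕ} (k : ℕ) (s : Fin n → ℝ) (i : ℕ) : ℝ :=
  (1 / (k : ℝ)) * ∑ j ∈ Finset.univ.filter (fun j : Fin n => (j : ℕ) / k = i), s j

variable {n k l : ℕ} {s : Fin n → ℝ}

theorem abs_bucketAvg_le_one (hk : 1 ≤ k) (hn : n = k * l) (hs : ∀ j, s j = 1 ∨ s j = -1) {i : ℕ}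
    (hi : i < l) : |bucketAvg k s i| ≤ 1 := by
  have hk0 : (0 : ℝ) < k := by exact_mod_cast hk
  rw [bucketAvg, abs_mul, abs_of_pos (by positivity), one_div, inv_mul_le_iff₀ hk0, mul_one]
  refine (Finset.abs_sum_le_sum_abs _ _).trans ?_
  have : ∀ j ∈ Finset.univ.filter (fun j : Fin n => (j : ℕ) / k = i), |s j| ≤ 1 := fun j _ => by
    rcases hs j with h | h <;> simp [h]
  refine (Finset.sum_le_sum this).trans ?_
  simp [card_filter_div_eq hk hn hi]

theorem bucketAvg_eq_of_forall_eq (hk : 1 ≤ k) (hn : n = k * l) {i : ℕ} (hi : i < l) {c : ℝ}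
    (h : ∀ j : Fin n, (j : ℕ) / k = i → s j = c) : bucketAvg k s i = c := by
  have hk0 : (0 : ℝ) < k := by exact_mod_cast hk
  rw [bucketAvg, Finset.sum_congr rfl fun j hj => h j (Finset.mem_filter.1 hj).2,
    Finset.sum_const, card_filter_div_eq hk hn hi, nsmul_eq_mul]
  field_simp

/-- Without a flip the labels in the bucket are constant and the left side vanishes; otherwise it is
at most `1`. A flip across the right end of the bucket is also counted, which only weakens the
bound. -/
theorem one_sub_bucketAvg_sq_le_card (hk : 1 ≤ k) (hn : n = k * l) (hs : ∀ j, s j = 1 ∨ s j = -1)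
    {i : ℕ} (hi : i < l) :
    1 - bucketAvg k s i ^ 2 ≤ ((flipSet s).filter fun j : Fin n => (j : ℕ) / k = i).card := by
  by_cases h0 : ((flipSet s).filter fun j : Fin n => (j : ℕ) / k = i).card = 0
  · have hlt : ∀ r, r < k → i * k + r < n := fun r hr => by
      have : (i + 1) * k ≤ l * k := Nat.mul_le_mul_right k hi
      rw [hn, mul_comm k l]
      rw [add_mul, one_mul] at this
      omega
    have hdiv : ∀ r, r < k → (i * k + r) / k = i := fun r hr => by
      rw [Nat.div_eq_iff (by omega)]; omega
    set c := s ⟨i * k + 0, hlt 0 hk⟩ with hc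
    have hconst : ∀ r (hr : r < k), s ⟨i * k + r, hlt r hr⟩ = c := by
      intro r
      induction r with
      | zero => intro _; rfl
      | succ r ih =>
        intro hr
        rw [← ih (by omega)]
        by_contra hne
        have hmem : (⟨i * k + r, hlt r (by omega)⟩ : Fin n) ∈
            (flipSet s).filter fun j : Fin n => (j : ℕ) / k = i :=
          Finset.mem_filter.2 ⟨mem_flipSet.2 ⟨hlt (r + 1) hr, hne⟩, hdiv r (by omega)⟩
        rw [Finset.card_eq_zero.1 h0] at hmem
        simp at hmem
    have hall : ∀ j : Fin n, (j : ℕ) / k = i → s j = c := by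
      intro j hj
      rw [Nat.div_eq_iff (by omega)] at hj
      have := hconst (j - i * k) (by omega)
      rw [← this]
      congr 1
      ext
      simp only
      omega
    rw [bucketAvg_eq_of_forall_eq hk hn hi hall, h0]
    rcases hs ⟨i * k + 0, hlt 0 hk⟩ with h | h <;> rw [hc, h] <;> norm_num
  · have h1 : (1 : ℝ) ≤ ((flipSet s).filter fun j : Fin n => (j : ℕ) / k = i).card := by
      exact_mod_cast Nat.one_le_iff_ne_zero.2 h0
    nlinarith [sq_nonneg (bucketAvg k s i)]

theorem sum_one_sub_bucketAvg_sq_le_card_flipSet (hk : 1 ≤ k) (hn : n = k * l)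
    (hs : ∀ j, s j = 1 ∨ s j = -1) :
    ∑ i : Fin l, (1 - bucketAvg k s i ^ 2) ≤ ((flipSet s).card : ℝ) := by
  have h1 := Finset.card_eq_sum_card_fiberwise (s := flipSet s) (t := Finset.range l)
    (f := fun j : Fin n => (j : ℕ) / k) fun j _ => by
      simp only [Finset.coe_range, Set.mem_Iio]
      exact Nat.div_lt_of_lt_mul (hn ▸ j.2)
  rw [h1, Finset.sum_range]
  push_cast
  exact Finset.sum_le_sum fun i _ => one_sub_bucketAvg_sq_le_card hk hn hs i.2

end BucketAverages

/-! ### Deterministic analysis of the estimator -/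

section Deterministic

variable {n d k l : ℕ}

theorem inner_bucketMean (y : EuclideanSpace ℝ (Fin d)) (x : Fin n → EuclideanSpace ℝ (Fin d))
    (i : Fin l) : inner ℝ y (bucketMean k x i) =
      1 / (k : ℝ) * ∑ j ∈ Finset.univ.filter (fun j : Fin n => (j : ℕ) / k = i),
        inner ℝ y (x j) := by
  rw [bucketMean, inner_smul_right, inner_sum]

theorem bucketMean_signal_add_noise {s : Fin n → ℝ} {θ : EuclideanSpace ℝ (Fin d)}
    {x : Fin n → EuclideanSpace ℝ (Fin d)} (i : Fin l) :
    bucketMean k (fun j => s j • θ + x j) i = bucketAvg k s i • θ + bucketMean k x i := by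
  simp only [bucketMean, bucketAvg]
  rw [Finset.sum_add_distrib, ← Finset.sum_smul, smul_add, smul_smul]

theorem toEuclideanLin_sampleCov_apply (y : Fin n → EuclideanSpace ℝ (Fin d))
    (u : EuclideanSpace ℝ (Fin d)) :
    Matrix.toEuclideanLin (sampleCov k l y) u =
      (1 / (l : ℝ)) • ∑ i : Fin l, inner ℝ (bucketMean k y i) u • bucketMean k y i := by
  ext a
  simp only [Matrix.toEuclideanLin, Matrix.ofLp_toLpLin, Matrix.toLin'_apply, sampleCov,
    Matrix.smul_mulVec, PiLp.smul_apply, Pi.smul_apply, WithLp.ofLp_sum, Finset.sum_apply,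
    WithLp.ofLp_smul]
  congr 1
  rw [← Matrix.mulVec_mulVec, Matrix.mulVec, dotProduct]
  refine Finset.sum_congr rfl fun i _ => ?_
  rw [smul_eq_mul, mul_comm, PiLp.inner_apply]
  congr 1
  simp [Matrix.mulVec, dotProduct, bucketMatrix, mul_comm]

theorem isSymmetric_toEuclideanLin_sampleCov (y : Fin n → EuclideanSpace ℝ (Fin d)) :
    (Matrix.toEuclideanLin (sampleCov k l y)).IsSymmetric := by
  intro u v
  simp only [toEuclideanLin_sampleCov_apply, inner_smul_left, inner_smul_right, sum_inner,
    inner_sum, conj_trivial]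
  congr 1
  refine Finset.sum_congr rfl fun i _ => ?_
  rw [real_inner_comm u, mul_comm]

theorem bucketAvg_sq_le_one (hk : 1 ≤ k) (hn : n = k * l) {s : Fin n → ℝ}
    (hs : ∀ j, s j = 1 ∨ s j = -1) (i : Fin l) : bucketAvg k s i ^ 2 ≤ 1 :=
  (sq_le_one_iff_abs_le_one _).2 (abs_bucketAvg_le_one hk hn hs i.2)

/-- The average over the buckets of the products of the bucket labels and the bucket noises, that
is, the cross term of the sample covariance. -/
noncomputable def crossNoise (k l : ℕ) (s : Fin n → ℝ) (x : Fin n → EuclideanSpace ℝ (Fin d)) :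
    EuclideanSpace ℝ (Fin d) :=
  (1 / (l : ℝ)) • ∑ i : Fin l, bucketAvg k s i • bucketMean k x i

/-- Deterministic bound for the loss of the spectral estimator in terms of the fraction of
corrupted buckets, the cross term, and the deviation of the noise covariance. -/
theorem signLoss_spectral_le (hk : 1 ≤ k) (hl : 1 ≤ l) (hn : n = k * l) {s : Fin n → ℝ}
    (hs : ∀ j, s j = 1 ∨ s j = -1) {θ : EuclideanSpace ℝ (Fin d)} (hθ : θ ≠ 0)
    {x : Fin n → EuclideanSpace ℝ (Fin d)} {ν : ℝ}
    (hν : ∀ u, ‖Matrix.toEuclideanLin (sampleCov k l x) u - (1 / (k : ℝ)) • u‖ ≤ ν * ‖u‖)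
    {T : (Fin n → EuclideanSpace ℝ (Fin d)) → EuclideanSpace ℝ (Fin d)}
    (hT : IsSpectralEstimator k l T) :
    signLoss (T fun j => s j • θ + x j) θ ≤
      10 * ((1 / (l : ℝ) * ∑ i : Fin l, (1 - bucketAvg k s i ^ 2)) * ‖θ‖ +
        2 * ‖crossNoise k l s x‖ + ν / ‖θ‖) := by
  set y : Fin n → EuclideanSpace ℝ (Fin d) := fun j => s j • θ + x j with hy
  obtain ⟨v, ⟨hv1, hv2⟩, hTv⟩ := hT y
  have hl0 : (0 : ℝ) < l := by exact_mod_cast hl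
  have hθ0 : 0 < ‖θ‖ := norm_pos_iff.2 hθ
  set w := crossNoise k l s x with hw
  set μ := 1 / (l : ℝ) * ∑ i : Fin l, (1 - bucketAvg k s i ^ 2) with hμ
  have hμ0 : 0 ≤ μ := mul_nonneg (by positivity)
    (Finset.sum_nonneg fun i _ => sub_nonneg.2 (bucketAvg_sq_le_one hk hn hs i))
  have hμ' : 1 / (l : ℝ) * ∑ i : Fin l, bucketAvg k s i ^ 2 = 1 - μ := by
    rw [hμ, Finset.sum_sub_distrib]
    simp only [Finset.sum_const, Finset.card_univ, Fintype.card_fin, nsmul_eq_mul, mul_one]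
    field_simp
    ring
  -- The four error terms: the signal lost to flips, the two halves of the symmetric cross term, and
  -- the noise covariance centred at `I/k`.
  have hexp : ∀ u, Matrix.toEuclideanLin (sampleCov k l y) u - (1 / (k : ℝ)) • u -
      inner ℝ θ u • θ = -(μ * inner ℝ θ u) • θ + inner ℝ θ u • w + inner ℝ w u • θ +
        (Matrix.toEuclideanLin (sampleCov k l x) u - (1 / (k : ℝ)) • u) := by
    intro u
    have h1 : Matrix.toEuclideanLin (sampleCov k l y) u = ((1 - μ) * inner ℝ θ u) • θ +
        inner ℝ θ u • w + inner ℝ w u • θ + Matrix.toEuclideanLin (sampleCov k l x) u := by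
      rw [toEuclideanLin_sampleCov_apply, toEuclideanLin_sampleCov_apply, ← hμ', hw, crossNoise]
      simp only [hy, bucketMean_signal_add_noise, inner_smul_left, sum_inner, inner_add_left,
        conj_trivial, Finset.mul_sum, Finset.sum_mul, Finset.sum_smul, Finset.smul_sum]
      rw [← Finset.sum_add_distrib, ← Finset.sum_add_distrib, ← Finset.sum_add_distrib]
      refine Finset.sum_congr rfl fun i _ => ?_
      module
    rw [h1]
    module
  have happrox : ∀ u, ‖Matrix.toEuclideanLin (sampleCov k l y) u - (1 / (k : ℝ)) • u -
      inner ℝ θ u • θ‖ ≤ (μ * ‖θ‖ ^ 2 + 2 * ‖θ‖ * ‖w‖ + ν) * ‖u‖ := by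
    intro u
    rw [hexp u]
    refine (norm_add_le _ _).trans ?_
    have h1 : ‖-(μ * inner ℝ θ u) • θ‖ ≤ μ * ‖θ‖ ^ 2 * ‖u‖ := by
      rw [norm_smul, norm_neg, norm_mul, Real.norm_of_nonneg hμ0, Real.norm_eq_abs]
      have := mul_le_mul_of_nonneg_left (abs_real_inner_le_norm θ u) (mul_nonneg hμ0 hθ0.le)
      linarith
    have h2 : ‖inner ℝ θ u • w‖ ≤ ‖θ‖ * ‖w‖ * ‖u‖ := by
      rw [norm_smul, Real.norm_eq_abs]
      have := mul_le_mul_of_nonneg_left (abs_real_inner_le_norm θ u) (norm_nonneg w)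
      linarith
    have h3 : ‖inner ℝ w u • θ‖ ≤ ‖θ‖ * ‖w‖ * ‖u‖ := by
      rw [norm_smul, Real.norm_eq_abs]
      have := mul_le_mul_of_nonneg_left (abs_real_inner_le_norm w u) hθ0.le
      linarith
    have h4 := (norm_add_le (-(μ * inner ℝ θ u) • θ + inner ℝ θ u • w) (inner ℝ w u • θ)).trans
      (add_le_add_left (norm_add_le _ _) _)
    have h5 := hν u
    linarith
  have hmain := min_norm_sub_norm_add_le_of_top_eigenpair hθ hv1 hv2
    (inner_toEuclideanLin_le_lambdaMax (isSymmetric_toEuclideanLin_sampleCov y)) happrox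
  rw [signLoss, hTv]
  refine hmain.trans_eq ?_
  congr 1
  field_simp

theorem norm_sampleCov_noise_sub_le (hk : 1 ≤ k) (hl : 1 ≤ l) (hn : n = k * l) (hd : 1 ≤ d)
    {N : Finset (EuclideanSpace ℝ (Fin d))} (hN1 : ∀ y ∈ N, ‖y‖ = 1)
    (hN : ∀ x : EuclideanSpace ℝ (Fin d), ‖x‖ = 1 → ∃ y ∈ N, ‖y - x‖ ≤ 1 / 2)
    {x : Fin n → EuclideanSpace ℝ (Fin d)} {τ : ℝ}
    (hx : ∀ y ∈ N, |∑ i : Fin l, ((∑ j ∈ Finset.univ.filter (fun j : Fin n => (j : ℕ) / k = i),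
      inner ℝ y (x j)) ^ 2 - k)| ≤ τ * k) (u : EuclideanSpace ℝ (Fin d)) :
    ‖Matrix.toEuclideanLin (sampleCov k l x) u - (1 / (k : ℝ)) • u‖ ≤ 2 * (τ / n) * ‖u‖ := by
  have hl0 : (0 : ℝ) < l := by exact_mod_cast hl
  have hk0 : (0 : ℝ) < k := by exact_mod_cast hk
  have : Nonempty (Fin d) := ⟨⟨0, hd⟩⟩
  set S : EuclideanSpace ℝ (Fin d) →ₗ[ℝ] EuclideanSpace ℝ (Fin d) :=
    Matrix.toEuclideanLin (sampleCov k l x) - (1 / (k : ℝ)) • LinearMap.id with hS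
  have hSsymm : S.IsSymmetric := by
    intro u v
    have := isSymmetric_toEuclideanLin_sampleCov (k := k) (l := l) x u v
    simp only [hS, LinearMap.sub_apply, LinearMap.smul_apply, LinearMap.id_apply, inner_sub_left,
      inner_sub_right, inner_smul_left, inner_smul_right, conj_trivial, this]
  refine hSsymm.norm_apply_le_of_half_net hN1 hN (fun y hy => ?_) u
  have h1 : inner ℝ (S y) y = (∑ i : Fin l,
      ((∑ j ∈ Finset.univ.filter (fun j : Fin n => (j : ℕ) / k = i),
        inner ℝ y (x j)) ^ 2 - k)) / (k * n) := by
    have h2 : ∀ i : Fin l, inner ℝ (bucketMean k x i) y * inner ℝ (bucketMean k x i) y =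
        (∑ j ∈ Finset.univ.filter (fun j : Fin n => (j : ℕ) / k = i),
        inner ℝ y (x j)) ^ 2 / k ^ 2 := fun i => by
      rw [real_inner_comm, inner_bucketMean]
      field_simp
    simp only [hS, LinearMap.sub_apply, LinearMap.smul_apply, LinearMap.id_apply, inner_sub_left,
      inner_smul_left, toEuclideanLin_sampleCov_apply, sum_inner, conj_trivial,
      real_inner_self_eq_norm_sq, hN1 y hy, h2, ← Finset.sum_div, Finset.sum_sub_distrib]
    simp only [Finset.sum_const, Finset.card_univ, Fintype.card_fin, nsmul_eq_mul, hn]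
    push_cast
    field_simp
  have hn0 : (0 : ℝ) < n := by rw [hn]; push_cast; positivity
  rw [h1, abs_div, abs_of_pos (by positivity : (0 : ℝ) < k * n), div_le_div_iff₀ (by positivity) hn0]
  have := mul_le_mul_of_nonneg_right (hx y hy) hn0.le
  linarith

/-- Regrouping by observation instead of by bucket exhibits the cross term as a linear combination
of independent scalars, the form the Hoeffding bound needs. -/
theorem inner_crossNoise (hk : 1 ≤ k) (hl : 1 ≤ l) (hn : n = k * l) (s : Fin n → ℝ)
    (x : Fin n → EuclideanSpace ℝ (Fin d)) (y : EuclideanSpace ℝ (Fin d)) :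
    inner ℝ y (crossNoise k l s x) =
      (∑ j : Fin n, bucketAvg k s ((j : ℕ) / k) * inner ℝ y (x j)) / n := by
  have hl0 : (0 : ℝ) < l := by exact_mod_cast hl
  have hk0 : (0 : ℝ) < k := by exact_mod_cast hk
  rw [crossNoise, inner_smul_right, inner_sum]
  simp only [inner_smul_right, inner_bucketMean]
  have h1 : ∑ j : Fin n, bucketAvg k s ((j : ℕ) / k) * inner ℝ y (x j) =
      ∑ i : Fin l, bucketAvg k s i *
        ∑ j ∈ Finset.univ.filter (fun j : Fin n => (j : ℕ) / k = i), inner ℝ y (x j) := by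
    rw [← Finset.sum_fiberwise_of_maps_to (s := Finset.univ) (t := Finset.range l)
      (g := fun j : Fin n => (j : ℕ) / k)
      (fun j _ => Finset.mem_range.2 (Nat.div_lt_of_lt_mul (hn ▸ j.2))), Finset.sum_range]
    refine Finset.sum_congr rfl fun i _ => ?_
    rw [Finset.mul_sum]
    refine Finset.sum_congr rfl fun j hj => ?_
    rw [(Finset.mem_filter.1 hj).2]
  rw [h1, Finset.mul_sum, Finset.sum_div]
  refine Finset.sum_congr rfl fun i _ => ?_
  have : (n : ℝ) = k * l := by rw [hn]; push_cast; rfl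
  rw [this]
  field_simp

end Deterministic

/-! ### The exceptional event and the union bound over the net -/

section GoodEvent

variable {Ω : Type*} [MeasurableSpace Ω] {P : Measure Ω} {n d k l : ℕ} {δ : ℝ}
  {θ : EuclideanSpace ℝ (Fin d)} {η : Fin n → Ω → ℝ}
  {ξ Y : Fin n → Ω → EuclideanSpace ℝ (Fin d)}

/-- The coefficients are random but independent of the noise and at most `1` in modulus, so the
bound for fixed labels survives averaging over them. -/
theorem IsMarkovMixture.measureReal_cross_ge_le [IsProbabilityMeasure P]
    (h : IsMarkovMixture P δ θ η ξ Y) (hk : 1 ≤ k) (hn1 : 1 ≤ n) (hn : n = k * l)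
    {y : EuclideanSpace ℝ (Fin d)} (hy : ‖y‖ = 1) :
    P.real {ω | 3 * √((d : ℝ) * n) ≤ |∑ j : Fin n,
      bucketAvg k (fun r => η r ω) ((j : ℕ) / k) * inner ℝ y (ξ j ω)|} ≤
      2 * Real.exp (-4 * d) := by
  have hsub : ∀ j, HasSubgaussianMGF (fun ω => inner ℝ y (ξ j ω)) 1 P := fun j =>
    (h.noise_subGaussian j).hasSubgaussianMGF_inner hy
  have hind : iIndepFun (fun j ω => inner ℝ y (ξ j ω)) P :=
    h.noise_indep.comp (fun _ x => inner ℝ y x) fun _ => by fun_prop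
  set S : Set (Fin n → ℝ) := {s | ∀ j, s j = 1 ∨ s j = -1} with hS
  have hSm : MeasurableSet S := by
    have : S = ⋂ j, (fun s : Fin n → ℝ => s j) ⁻¹' {1, -1} := by
      ext s; simp [hS]
    rw [this]
    exact MeasurableSet.iInter fun j => measurable_pi_apply j
      ((measurableSet_singleton _).insert _)
  set B : Set ((Fin n → ℝ) × (Fin n → EuclideanSpace ℝ (Fin d))) :=
    {p | 3 * √((d : ℝ) * n) ≤ |∑ j : Fin n,
      bucketAvg k p.1 ((j : ℕ) / k) * inner ℝ y (p.2 j)|} with hB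
  have hBm : MeasurableSet B := by
    refine measurableSet_le measurable_const (Measurable.abs ?_)
    refine Finset.measurable_sum _ fun j _ => Measurable.mul ?_ ?_
    · unfold bucketAvg
      fun_prop
    · fun_prop
  have key := h.indep.measure_le_of_forall (measurable_pi_lambda _ h.chain.measurable)
    (measurable_pi_lambda _ h.noise_measurable) hSm (fun ω j => h.chain.sign j ω) hBm
    (p := ENNReal.ofReal (2 * Real.exp (-4 * d))) fun s hs => by
      have := hind.measureReal_abs_linear_comb_ge_le hn1 hsub
        (c := fun j => bucketAvg k s ((j : ℕ) / k))
        (fun j => abs_bucketAvg_le_one hk hn hs (Nat.div_lt_of_lt_mul (hn ▸ j.2))) d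
      rw [← ofReal_measureReal]
      exact ENNReal.ofReal_le_ofReal this
  exact ENNReal.toReal_le_of_le_ofReal (by positivity) key

theorem IsMarkovMixture.measureReal_noise_quadratic_ge_le [IsProbabilityMeasure P]
    (h : IsMarkovMixture P δ θ η ξ Y) (hk : 1 ≤ k) (hl : 1 ≤ l) (hn : n = k * l)
    {y : EuclideanSpace ℝ (Fin d)} (hy : ‖y‖ = 1) :
    P.real {ω | 128 * (√((d : ℝ) * l) + d) * k ≤ |∑ i : Fin l,
      ((∑ j ∈ Finset.univ.filter (fun j : Fin n => (j : ℕ) / k = i),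
        inner ℝ y (ξ j ω)) ^ 2 - k)|} ≤ 2 * Real.exp (-4 * d) := by
  refine measureReal_abs_sum_bucket_sq_sub_ge_le hk hl hn
    (X := fun j ω => inner ℝ y (ξ j ω))
    (h.noise_indep.comp (fun _ x => inner ℝ y x) fun _ => by fun_prop) (fun j => ?_)
    (fun j => (h.noise_subGaussian j).hasSubgaussianMGF_inner hy) (fun j => ?_) d
  · have := h.noise_measurable j
    fun_prop
  · rw [(h.noise_isotropic j).integral_inner_sq (h.noise_subGaussian j), hy, one_pow]

/-- Outside an event of exponentially small probability, the number of flips, the cross term and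
the noise covariance are all under control. -/
theorem IsMarkovMixture.exists_bad_event [IsProbabilityMeasure P]
    (h : IsMarkovMixture P δ θ η ξ Y) (hδ : 0 ≤ δ) (hk : 1 ≤ k) (hl : 1 ≤ l) (hd : 1 ≤ d)
    (hn : n = k * l) :
    ∃ B : Set Ω, P B ≤ ENNReal.ofReal (5 * Real.exp (-d)) ∧ ∀ ω, ω ∉ B →
      (d ≤ l → ((flipSet fun r => η r ω).card : ℝ) ≤ 2 * δ * n + √((d : ℝ) * l)) ∧
      ‖crossNoise k l (fun r => η r ω) (fun j => ξ j ω)‖ ≤ 6 * (√((d : ℝ) * n) / n) ∧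
      ∀ u, ‖Matrix.toEuclideanLin (sampleCov k l fun j => ξ j ω) u - (1 / (k : ℝ)) • u‖ ≤
        256 * ((√((d : ℝ) * l) + d) / n) * ‖u‖ := by
  have hn1 : 1 ≤ n := by rw [hn]; exact Nat.mul_pos hk hl
  have hn0 : (0 : ℝ) < n := by exact_mod_cast hn1
  obtain ⟨N, hNc, hN1, hN⟩ := exists_half_net_sphere (E := EuclideanSpace ℝ (Fin d))
  rw [finrank_euclideanSpace_fin] at hNc
  have hnet : (N.card : ℝ) * (2 * Real.exp (-4 * d)) ≤ 2 * Real.exp (-d) := by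
    have h5 : (5 : ℝ) ≤ Real.exp 3 := by
      have : Real.exp 3 = Real.exp 1 ^ 3 := by rw [← Real.exp_nat_mul]; norm_num
      rw [this]
      calc (5 : ℝ) ≤ 2 ^ 3 := by norm_num
        _ ≤ _ := by gcongr; linarith [Real.exp_one_gt_d9]
    have h6 : (N.card : ℝ) ≤ Real.exp (3 * d) := by
      calc (N.card : ℝ) ≤ 5 ^ d := by exact_mod_cast hNc
        _ ≤ Real.exp 3 ^ d := by gcongr
        _ = _ := by rw [← Real.exp_nat_mul, mul_comm]
    calc (N.card : ℝ) * (2 * Real.exp (-4 * d))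
        ≤ Real.exp (3 * d) * (2 * Real.exp (-4 * d)) := by gcongr
      _ = 2 * (Real.exp (3 * d) * Real.exp (-4 * d)) := by ring
      _ = _ := by rw [← Real.exp_add]; congr 2; ring
  -- The restriction `d ≤ l` ensures `√(d l) ≥ d`, hence a tail of `exp(-d)`. For `d > l` no control
  -- of the flips is needed.
  set BF : Set Ω := {ω | d ≤ l ∧ 2 * δ * n + √((d : ℝ) * l) ≤ (flipSet fun r => η r ω).card}
    with hBF
  set BW : EuclideanSpace ℝ (Fin d) → Set Ω := fun y => {ω | 3 * √((d : ℝ) * n) ≤ |∑ j : Fin n,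
      bucketAvg k (fun r => η r ω) ((j : ℕ) / k) * inner ℝ y (ξ j ω)|} with hBW
  set BS : EuclideanSpace ℝ (Fin d) → Set Ω := fun y =>
    {ω | 128 * (√((d : ℝ) * l) + d) * k ≤ |∑ i : Fin l,
      ((∑ j ∈ Finset.univ.filter (fun j : Fin n => (j : ℕ) / k = i),
        inner ℝ y (ξ j ω)) ^ 2 - k)|} with hBS
  have hPF : P.real BF ≤ Real.exp (-d) := by
    by_cases hdl : d ≤ l
    · have h1 : P.real BF ≤ Real.exp (-√((d : ℝ) * l)) := by
        refine le_trans (measureReal_mono fun ω hω => hω.2)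
          (h.chain.measureReal_card_flipSet_ge_le hδ hn1 (√((d : ℝ) * l)))
      refine h1.trans (Real.exp_le_exp.2 (neg_le_neg ?_))
      have h2 : (d : ℝ) ≤ l := by exact_mod_cast hdl
      refine Real.le_sqrt_of_sq_le ?_
      nlinarith [(Nat.cast_nonneg d : (0 : ℝ) ≤ d)]
    · have : BF = ∅ := by
        ext ω
        simp [hBF, hdl]
      rw [this, measureReal_empty]
      exact (Real.exp_pos _).le
  have hunion : ∀ A : EuclideanSpace ℝ (Fin d) → Set Ω,
      (∀ y ∈ N, P.real (A y) ≤ 2 * Real.exp (-4 * d)) →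
      P.real (⋃ y ∈ N, A y) ≤ 2 * Real.exp (-d) := fun A hA => by
    refine (measureReal_biUnion_finset_le N A).trans (le_trans (Finset.sum_le_sum hA) ?_)
    rw [Finset.sum_const, nsmul_eq_mul]
    exact hnet
  have hPW := hunion BW fun y hy => h.measureReal_cross_ge_le hk hn1 hn (hN1 y hy)
  have hPS := hunion BS fun y hy => h.measureReal_noise_quadratic_ge_le hk hl hn (hN1 y hy)
  refine ⟨BF ∪ (⋃ y ∈ N, BW y) ∪ ⋃ y ∈ N, BS y, ?_, fun ω hω => ?_⟩
  · rw [← ofReal_measureReal]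
    refine ENNReal.ofReal_le_ofReal ?_
    have h1 := measureReal_union_le (μ := P) (BF ∪ ⋃ y ∈ N, BW y) (⋃ y ∈ N, BS y)
    have h2 := measureReal_union_le (μ := P) BF (⋃ y ∈ N, BW y)
    linarith
  · simp only [Set.mem_union, Set.mem_iUnion, not_or, not_exists] at hω
    obtain ⟨⟨hF, hW⟩, hS⟩ := hω
    refine ⟨fun hdl => ?_, ?_, ?_⟩
    · by_contra hcon
      exact hF ⟨hdl, (not_le.1 hcon).le⟩
    · have h1 := norm_le_two_mul_of_half_net hN (t := 3 * √((d : ℝ) * n) / n) (by positivity)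
        (w := crossNoise k l (fun r => η r ω) (fun j => ξ j ω)) fun y hy => by
          rw [inner_crossNoise hk hl hn]
          gcongr
          exact (le_abs_self _).trans (not_le.1 (hW y hy)).le
      refine h1.trans_eq ?_
      ring
    · intro u
      refine (norm_sampleCov_noise_sub_le hk hl hn hd hN1 hN
        (τ := 128 * (√((d : ℝ) * l) + d)) (fun y hy => (not_le.1 (hS y hy)).le) u).trans_eq ?_
      ring

end GoodEvent

/-! ### Assembly of the two regimes -/

theorem theorem3 :
    ∃ C c₀ c₁ : ℝ, 0 < C ∧ 0 < c₀ ∧ 0 < c₁ ∧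
      ∀ (n d k l : ℕ), 1 ≤ n → 1 ≤ d → n = k * l →
      ∀ (δ : ℝ), 0 < δ → δ < 1 / 2 →
      ∀ (θ : EuclideanSpace ℝ (Fin d))
        (Ω : Type*) [MeasurableSpace Ω] (P : Measure Ω) [IsProbabilityMeasure P]
        (η : Fin n → Ω → ℝ) (ξ Y : Fin n → Ω → EuclideanSpace ℝ (Fin d)),
        IsMarkovMixture P δ θ η ξ Y →
      ∀ (T : (Fin n → EuclideanSpace ℝ (Fin d)) → EuclideanSpace ℝ (Fin d)),
        IsSpectralEstimator k l T →
        (θ ≠ 0 → ‖θ‖ ^ 2 ≤ 1 →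
          P {ω | ¬ signLoss (T fun i => Y i ω) θ ≤
              C * ((√((d : ℝ) / l) + (n : ℝ) * δ / l) * ‖θ‖ + √((d : ℝ) / n)
                + 1 / ‖θ‖ * (√(1 / (k : ℝ)) * √((d : ℝ) / n) + (d : ℝ) / n))}
            ≤ ENNReal.ofReal (c₁ * Real.exp (-c₀ * d))) ∧
        (1 ≤ ‖θ‖ ^ 2 → l = n →
          P {ω | ¬ signLoss (T fun i => Y i ω) θ ≤ C * (√((d : ℝ) / n) + (d : ℝ) / n)}
            ≤ ENNReal.ofReal (c₁ * Real.exp (-c₀ * d))) := by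
  -- `2680 = 10 (12 + 256)`, since the cross term and the noise covariance both contribute `√(d/n)`
  -- in the second regime. `5 = 1 + 2 + 2` counts the flips and the two net bounds.
  refine ⟨2680, 1, 5, by norm_num, by norm_num, by norm_num, ?_⟩
  intro n d k l hn1 hd hn δ hδ _ θ Ω _ P _ η ξ Y h T hT
  have hk : 1 ≤ k := Nat.one_le_iff_ne_zero.2 fun h0 => by simp [h0] at hn; omega
  have hl : 1 ≤ l := Nat.one_le_iff_ne_zero.2 fun h0 => by simp [h0] at hn; omega
  have hn0 : (0 : ℝ) < n := by exact_mod_cast hn1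
  have hk0 : (0 : ℝ) < k := by exact_mod_cast hk
  have hl0 : (0 : ℝ) < l := by exact_mod_cast hl
  have hd0 : (0 : ℝ) ≤ d := Nat.cast_nonneg d
  have hnkl : (n : ℝ) = k * l := by rw [hn]; push_cast; rfl
  obtain ⟨B, hPB, hB⟩ := h.exists_bad_event hδ.le hk hl hd hn
  have hexp : ENNReal.ofReal (5 * Real.exp (-d)) =
      ENNReal.ofReal (5 * Real.exp (-1 * d)) := by rw [neg_one_mul]
  rw [hexp] at hPB
  have hYω : ∀ ω, (fun i => Y i ω) = fun j => η j ω • θ + ξ j ω := fun ω =>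
    funext fun j => h.model j ω
  have hsqrt : ∀ {a b : ℝ}, 0 ≤ a → 0 < b → √(a * b) / b = √(a / b) := fun {a b} ha hb => by
    rw [show a / b = a * b / b ^ 2 by field_simp, Real.sqrt_div (by positivity),
      Real.sqrt_sq hb.le]
  have hloss : ∀ ω, ω ∉ B → θ ≠ 0 → signLoss (T fun i => Y i ω) θ ≤
      10 * ((1 / (l : ℝ) * ∑ i : Fin l, (1 - bucketAvg k (fun r => η r ω) i ^ 2)) * ‖θ‖ +
        12 * √((d : ℝ) / n) + 256 * ((√((d : ℝ) * l) + d) / n) / ‖θ‖) := by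
    intro ω hω hθ
    obtain ⟨-, hw, hS⟩ := hB ω hω
    rw [hYω ω]
    refine (signLoss_spectral_le hk hl hn (fun j => h.chain.sign j ω) hθ hS hT).trans ?_
    rw [hsqrt hd0 hn0] at hw
    linarith
  constructor
  · intro hθ _
    have hθ0 : 0 < ‖θ‖ := norm_pos_iff.2 hθ
    -- Monotonicity holds for arbitrary sets, so the choice of eigenvector in `T` need not be
    -- measurable.
    refine le_trans (measure_mono fun ω hω => ?_) hPB
    by_contra hωB
    refine hω ((hloss ω hωB hθ).trans ?_)
    have hm : 1 / (l : ℝ) * ∑ i : Fin l, (1 - bucketAvg k (fun r => η r ω) i ^ 2) ≤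
        2 * (√((d : ℝ) / l) + (n : ℝ) * δ / l) := by
      have hδl : 0 ≤ (n : ℝ) * δ / l := by positivity
      rw [one_div, inv_mul_le_iff₀ hl0]
      -- For `d > l` the trivial bound suffices: the average is at most `1 ≤ √(d/l)`.
      rcases le_or_gt d l with hdl | hdl
      · refine (sum_one_sub_bucketAvg_sq_le_card_flipSet hk hn
          fun j => h.chain.sign j ω).trans (((hB ω hωB).1 hdl).trans ?_)
        rw [← hsqrt hd0 hl0]
        have h0 := Real.sqrt_nonneg ((d : ℝ) * l)
        have : (l : ℝ) * (2 * (√((d : ℝ) * l) / l + (n : ℝ) * δ / l)) =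
            2 * √((d : ℝ) * l) + 2 * δ * n := by field_simp
        linarith
      · have h1 : ∑ i : Fin l, (1 - bucketAvg k (fun r => η r ω) i ^ 2) ≤ (l : ℝ) := by
          refine (Finset.sum_le_sum (g := fun _ => (1 : ℝ)) fun i _ =>
            sub_le_self _ (sq_nonneg _)).trans_eq ?_
          simp
        have h2 : 1 ≤ √((d : ℝ) / l) := by
          rw [Real.one_le_sqrt, one_le_div hl0]
          exact_mod_cast hdl.le
        nlinarith
    have hν : (√((d : ℝ) * l) + d) / n = √(1 / (k : ℝ)) * √((d : ℝ) / n) + (d : ℝ) / n := by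
      rw [add_div, ← Real.sqrt_mul (by positivity)]
      congr 1
      rw [show (1 / (k : ℝ)) * (d / n) = d * l / n ^ 2 by rw [hnkl]; field_simp,
        Real.sqrt_div (by positivity), Real.sqrt_sq hn0.le]
    rw [hν]
    set a := √((d : ℝ) / l) + (n : ℝ) * δ / l
    set b := √(1 / (k : ℝ)) * √((d : ℝ) / n) + (d : ℝ) / n with hb
    have ha0 : 0 ≤ a := by positivity
    have hb0 : 0 ≤ b := by positivity
    have h1 := mul_le_mul_of_nonneg_right hm hθ0.le
    have h2 : 0 ≤ a * ‖θ‖ := by positivity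
    have h3 : 0 ≤ 1 / ‖θ‖ * b := by positivity
    have h4 : 256 * b / ‖θ‖ = 256 * (1 / ‖θ‖ * b) := by ring
    have h5 := Real.sqrt_nonneg ((d : ℝ) / n)
    rw [h4]
    linarith
  · intro hθ1 hln
    subst hln
    have hk1 : k = 1 := by
      have : k * l = 1 * l := by omega
      exact Nat.eq_of_mul_eq_mul_right hl this
    subst hk1
    have hθ1' : 1 ≤ ‖θ‖ := by
      by_contra hcon
      have := norm_nonneg θ
      nlinarith
    have hθ : θ ≠ 0 := fun h0 => by simp [h0] at hθ1'; linarith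
    refine le_trans (measure_mono fun ω hω => ?_) hPB
    by_contra hωB
    refine hω ((hloss ω hωB hθ).trans ?_)
    have hm : ∑ i : Fin l, (1 - bucketAvg 1 (fun r => η r ω) i ^ 2) = 0 := by
      refine Finset.sum_eq_zero fun i _ => ?_
      rw [bucketAvg_eq_of_forall_eq le_rfl hn i.2 (c := η i ω) fun j hj => by
        rw [Nat.div_one] at hj; rw [Fin.ext hj]]
      rcases h.chain.sign i ω with h' | h' <;> rw [h'] <;> norm_num
    have h1 : (√((d : ℝ) * l) + d) / l / ‖θ‖ ≤ √((d : ℝ) / l) + (d : ℝ) / l := by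
      rw [add_div, hsqrt hd0 hl0]
      exact div_le_self (by positivity) hθ1'
    have h2 : 0 ≤ (d : ℝ) / l := by positivity
    rw [hm, mul_zero, zero_mul, mul_div_assoc]
    linarith
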